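/- Let $p$ be an odd prime, $\zeta$ a primitive $p$-th root of unity, $\mathbb{K}=\mathbb{Q}(\zeta)$, and $G=\mathrm{Gal}(\mathbb{K}/\mathbb{Q})=\{\sigma_c : c\in(\mathbb{Z}/p)^\times\}$ with $\sigma_c(\zeta)=\zeta^c$ and $\jmath=\sigma_{-1}$. Let $\vartheta=\frac1p\sum_{c=1}^{p-1}c\,\sigma_c^{-1}$ be the Stickelberger element, $I=\vartheta\mathbb{Z}[G]\cap\mathbb{Z}[G]$ the Stickelberger ideal, $\mathcal{T}=(1-\jmath)I$ and $\widehat{\mathcal{T}}=\mathcal{T}/(p\mathbb{Z}[G]\cap\mathcal{T})$. Let $i_p$ be the irregularity index of $p$, i.e. the number of odd integers $0<i<p-1$ such that $p$ divides the numerator of the Bernoulli number $B_{p-i}$. The $p$-rank of a group is the largest $r$ such that it has a subgroup isomorphic to $(\mathbb{Z}/p)^r$. Put $\mu=p^2/(1-\zeta)$. For $\theta=\sum_{\sigma\in G}n_\sigma\sigma\in\mathbb{Z}[G]$ let $(1-\mu T)^\theta=\prod_{\sigma}(1-\sigma(\mu)T)^{n_\sigma}\in\mathbb{K}(T)$ and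 $$f[\theta](T)=\prod_{\sigma\in G}\ \sum_{n\ge0}(-\sigma(\mu))^n\binom{n_\sigma/p}{n}T^n=\sum_{n\ge 0}a_n(\theta)T^n\in\mathbb{K}[[T]].$$ Let $\mathbf{a}(\theta)=(\alpha_n(\theta))_{n\ge0}\in\mathbb{K}^{\mathbb{N}}$ with $\alpha_n=a_n/p^{e(n)}$, $e(n)=n-1-\lfloor n/(p-1)\rfloor$. Write $a_n(\theta)=\sum_{c=1}^{p-1}u_n^{(c)}(\theta)\zeta^c$ with $u^{(c)}_n(\theta)\in\mathbb{Q}$ and let $\mathbf{u}^{(c)}(\theta)=(u_n^{(c)}(\theta))_{n\ge0}\in\mathbb{Q}^{\mathbb{N}}$, $c\in(\mathbb{Z}/p)^\times$. Let $\mathbb{K}'=\mathbb{K}(T)$ and let $\mathbb{L}'$ be the extension of $\mathbb{K}'$ generated, in an algebraic closure, by all $p$-th roots $(1-\mu T)^{\theta/p}$ with $\theta\in\mathcal{T}$. (1) The extension $\mathbb{L}'/\mathbb{K}'$ is abelian, and $D:=\frac{p-1}{2}-i_p$ is equal both to the $p$-rank of $\widehat{\mathcal{T}}$ and to the $p$-rank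 of $\mathrm{Gal}(\mathbb{L}'/\mathbb{K}')$. (2) Let $r:\widehat{\mathcal{T}}\to\mathcal{T}$ choose a representative of every class. Then for every subset $\mathcal{F}\subset\widehat{\mathcal{T}}$ the family $(\mathbf{a}(r(t)))_{t\in\mathcal{F}}$ is linearly independent over $\mathbb{K}$. (3) There are $G$-equivariant choices $r$ of representatives. For each such $r$ and every subset $\mathcal{F}\subset\widehat{\mathcal{T}}$, the set of vectors $\{\mathbf{u}^{(c)}(r(t)) : t\in\widehat{\mathcal{T}},\ Gt\subset\mathcal{F},\ c\in(\mathbb{Z}/p)^\times\}$ is linearly independent over $\mathbb{Q}$; moreover $\mathbf{u}^{(c)}(r(t))=\mathbf{u}^{(c')}(r(t'))$ if and only if there is $b\in(\mathbb{Z}/p)^\times$ with $t'=\sigma_b t$ and $c'=bc$. -/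

import Mathlib

noncomputable section

namespace BinomialStickelberger

open scoped BigOperators

/-- The group `(ℤ/p)ˣ`. It is identified with `Gal(ℚ(ζ)/ℚ)` through `c ↦ σ_c`,
`σ_c ζ = ζ ^ c`; see `sigma` and `sigma_zeta` below. -/
abbrev G (p : ℕ) : Type := (ZMod p)ˣ

/-- The integral group ring `ℤ[G]`; the element `single c 1` is `σ_c`. -/
abbrev ZG (p : ℕ) : Type := MonoidAlgebra ℤ (G p)

/-- The rational group ring `ℚ[G]`. -/
abbrev QG (p : ℕ) : Type := MonoidAlgebra ℚ (G p)

/-- The inclusion `ℤ[G] → ℚ[G]`. -/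
def toQG (p : ℕ) : ZG p →+* QG p := MonoidAlgebra.mapRingHom (G p) (Int.castRingHom ℚ)

/-- The element `σ_c` of `ℤ[G]`. -/
def sig (p : ℕ) (c : G p) : ZG p := MonoidAlgebra.single c 1

/-- The Stickelberger element `ϑ = (1/p) ∑_{c=1}^{p-1} c σ_c⁻¹` of `ℚ[G]`. -/
def stickelbergerElement (p : ℕ) [Fact p.Prime] : QG p :=
  ∑ c : G p, MonoidAlgebra.single c⁻¹ (((c : ZMod p).val : ℚ) / (p : ℚ))

/-- The Stickelberger ideal `I = ϑ ℤ[G] ∩ ℤ[G]` of `ℤ[G]`. -/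
def stickelbergerIdeal (p : ℕ) [Fact p.Prime] : Ideal (ZG p) where
  carrier := {x | ∃ y : ZG p, toQG p x = stickelbergerElement p * toQG p y}
  add_mem' := by
    rintro a b ⟨y, hy⟩ ⟨z, hz⟩
    exact ⟨y + z, by rw [map_add, map_add, mul_add, hy, hz]⟩
  zero_mem' := ⟨0, by simp⟩
  smul_mem' := by
    rintro c x ⟨y, hy⟩
    exact ⟨c * y, by rw [smul_eq_mul, map_mul, map_mul, hy]; ring⟩

/-- The ideal `𝒯 = (1 - ȷ) I` of `ℤ[G]`, where `ȷ = σ_{-1}` is complex conjugation. -/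
def minusIdeal (p : ℕ) [Fact p.Prime] : Ideal (ZG p) :=
  Ideal.span {1 - sig p (-1)} * stickelbergerIdeal p

/-- The quotient `𝒯 / (p ℤ[G] ∩ 𝒯)`, a `ℤ[G]`-module. -/
abbrev THat (p : ℕ) [Fact p.Prime] : Type :=
  minusIdeal p ⧸
    Submodule.comap (minusIdeal p).subtype (Ideal.span {((p : ℕ) : ZG p)} : Ideal (ZG p))

/-- The class in the quotient of an element of `𝒯`. -/
def cls (p : ℕ) [Fact p.Prime] (θ : minusIdeal p) : THat p := Submodule.Quotient.mk θ

/-- The irregularity index of `p`: the number of odd `i < p - 1` such that `p` divides (the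
numerator of) the Bernoulli number `B_{p-i}`. -/
def irregularityIndex (p : ℕ) : ℕ :=
  ((Finset.range (p - 1)).filter fun i => Odd i ∧ (p : ℤ) ∣ (bernoulli (p - i)).num).card

/-- `r` is the `p`-rank of the group `A`: the largest `r` such that `A` has a subgroup isomorphic
to `(ℤ/p)^r`. -/
def HasPRank (p : ℕ) (A : Type*) [Group A] (r : ℕ) : Prop :=
  IsGreatest {s : ℕ | ∃ f : Multiplicative (Fin s → ZMod p) →* A, Function.Injective f} r

section Field

variable (p : ℕ) [Fact p.Prime] (K : Type*) [Field K] [NumberField K]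
  [IsCyclotomicExtension {p} ℚ K]

/-- The automorphism `σ_c` of the cyclotomic field `K`. -/
def sigma (c : G p) : Gal(K/ℚ) := (IsCyclotomicExtension.Rat.galEquivZMod p K).symm c

variable {K}

/-- `σ_c` maps a primitive `p`-th root of unity `ζ` to `ζ ^ c`. -/
theorem sigma_zeta {ζ : K} (hζ : IsPrimitiveRoot ζ p) (c : G p) :
    sigma p K c ζ = ζ ^ (c : ZMod p).val := by
  have h := IsCyclotomicExtension.Rat.galEquivZMod_apply_of_pow_eq p K (sigma p K c) hζ.pow_eq_one
  rw [h, sigma, MulEquiv.apply_symm_apply]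

/-- The number `μ = p² / (1 - ζ)`. -/
def mu (ζ : K) : K := (p : K) ^ 2 / (1 - ζ)

/-- The binomial series `(1 - σ(μ) T)^{k/p} = ∑_n (-σ(μ))^n binom(k/p, n) T^n`
with `σ = σ_c`, `k ∈ ℤ`. -/
def binomFactor (ζ : K) (k : ℤ) (c : G p) : PowerSeries K :=
  PowerSeries.mk fun n =>
    (-(sigma p K c (mu p ζ))) ^ n * algebraMap ℚ K (Ring.choose ((k : ℚ) / (p : ℚ)) n)

/-- The binomial series `f[θ](T)`, the product over all `c` of the series
`(1 - σ_c(μ) T)^{k_c/p}` for `θ = ∑_c k_c σ_c`. -/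
def binomSeries (ζ : K) (θ : ZG p) : PowerSeries K :=
  ∏ c : G p, binomFactor p ζ (θ.coeff c) c

/-- The coefficient `a_n(θ)` of `T^n` in `f[θ](T)`. -/
def coeffA (ζ : K) (θ : ZG p) (n : ℕ) : K := PowerSeries.coeff n (binomSeries p ζ θ)

/-- The infinite vector `(α_n(θ))_{n ≥ 0}` with `α_n = a_n / p^{e(n)}`, `e(n) = n - 1 - ⌊n/(p-1)⌋`. -/
def vecA (ζ : K) (θ : ZG p) : ℕ → K := fun n =>
  coeffA p ζ θ n / (p : K) ^ ((n : ℤ) - 1 - ((n / (p - 1) : ℕ) : ℤ))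

/-- The `c`-th rational coordinate of `x ∈ K` in the basis `ζ, ζ², …, ζ^{p-1}`,
`x_c = (Tr(ζ^{-c} x) - Tr(x)) / p`; see `sum_coord` and `coord_unique` below. -/
def coord (ζ : K) (c : G p) (x : K) : ℚ :=
  (Algebra.trace ℚ K ((ζ ^ (c : ZMod p).val)⁻¹ * x) - Algebra.trace ℚ K x) / (p : ℚ)

/-- The infinite vector `u^{(c)}(θ)` of the rational coordinates of the `a_n(θ)`, `n ≥ 0`. -/
def vecU (ζ : K) (c : G p) (θ : ZG p) : ℕ → ℚ := fun n => coord p ζ c (coeffA p ζ θ n)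

variable (K) in
/-- The field `K' = K(T)` of rational functions. -/
abbrev RatK : Type _ := RatFunc K

/-- The rational function `(1 - μ T)^θ = ∏_c (1 - σ_c(μ) T)^{k_c}` for `θ = ∑_c k_c σ_c`. -/
def kummerElt (ζ : K) (θ : ZG p) : RatK K :=
  ∏ c : G p, (1 - RatFunc.C (sigma p K c (mu p ζ)) * RatFunc.X) ^ (θ.coeff c)

/-- The extension `L'` of `K'`, generated inside an algebraic closure by all the `p`-th roots of
the `(1 - μ T)^θ`, `θ ∈ 𝒯`. -/
def kummerExt (ζ : K) : IntermediateField (RatK K) (AlgebraicClosure (RatK K)) :=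
  IntermediateField.adjoin (RatK K)
    {x | ∃ θ ∈ minusIdeal p, x ^ p = algebraMap (RatK K) _ (kummerElt p ζ θ)}

variable {p}

open Classical in
/-- The power sums of a `p`-th root of unity over the nonzero exponents. -/
theorem sum_units_pow {E : Type*} [Field E] {η : E} (hη : η ^ p = 1) :
    ∑ c : G p, η ^ (c : ZMod p).val = if η = 1 then (p : E) - 1 else -1 := by
  have hp : p.Prime := Fact.out
  have h1 : ∑ c : G p, η ^ (c : ZMod p).val + 1 = ∑ a : ZMod p, η ^ a.val := by
    rw [← Finset.sum_erase_add Finset.univ _ (Finset.mem_univ (0 : ZMod p))]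
    congr 1
    · refine Finset.sum_bij (fun c _ => (c : ZMod p)) ?_ ?_ ?_ ?_
      · intro c _
        simp
      · intro a _ b _ h
        exact Units.ext h
      · intro b hb
        exact ⟨Units.mk0 b (by simpa using hb), Finset.mem_univ _, rfl⟩
      · intro c _
        rfl
    · simp
  have h2 : ∑ a : ZMod p, η ^ a.val = ∑ i ∈ Finset.range p, η ^ i := by
    refine Finset.sum_bij (fun a _ => a.val) ?_ ?_ ?_ ?_
    · intro a _
      exact Finset.mem_range.2 (ZMod.val_lt a)
    · intro a _ b _ h
      exact ZMod.val_injective p h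
    · intro b hb
      exact ⟨(b : ZMod p), Finset.mem_univ _, ZMod.val_cast_of_lt (Finset.mem_range.1 hb)⟩
    · intro a _
      rfl
  split_ifs with h
  · subst h
    have : ∑ i ∈ Finset.range p, (1 : E) ^ i = p := by simp
    rw [← this, ← h2, ← h1]
    ring
  · have h3 : ∑ i ∈ Finset.range p, η ^ i = 0 := by
      rw [geom_sum_eq h, hη, sub_self, zero_div]
    rw [h2, h3] at h1
    exact eq_neg_of_add_eq_zero_left h1

/-- The trace as the sum over the `σ_c`. -/
theorem trace_eq_sum_sigma (x : K) :
    algebraMap ℚ K (Algebra.trace ℚ K x) = ∑ d : G p, sigma p K d x := by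
  have : IsGalois ℚ K := IsCyclotomicExtension.isGalois {p} ℚ K
  rw [trace_eq_sum_automorphisms]
  exact (Equiv.sum_comp (IsCyclotomicExtension.Rat.galEquivZMod p K).symm.toEquiv
    (fun s : Gal(K/ℚ) => s x)).symm

/-- Every `x` is the combination of the `ζ^c` with coefficients `coord p ζ c x`. -/
theorem sum_coord {ζ : K} (hζ : IsPrimitiveRoot ζ p) (x : K) :
    x = ∑ c : G p, algebraMap ℚ K (coord p ζ c x) * ζ ^ (c : ZMod p).val := by
  have hp : p.Prime := Fact.out
  have hp0 : (p : K) ≠ 0 := Nat.cast_ne_zero.2 hp.ne_zero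
  have hζ0 : ζ ≠ 0 := hζ.ne_zero hp.ne_zero
  have hζ1 : ζ ≠ 1 := hζ.ne_one hp.one_lt
  have key : ∀ c : G p, algebraMap ℚ K (coord p ζ c x) * ζ ^ (c : ZMod p).val =
      ∑ d : G p, (sigma p K d x / p) *
        (((ζ ^ (d : ZMod p).val)⁻¹ * ζ) ^ (c : ZMod p).val - ζ ^ (c : ZMod p).val) := by
    intro c
    unfold coord
    rw [map_div₀, map_sub, trace_eq_sum_sigma (p := p), trace_eq_sum_sigma (p := p),
      ← Finset.sum_sub_distrib, Finset.sum_div, Finset.sum_mul]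
    refine Finset.sum_congr rfl fun d _ => ?_
    rw [map_mul, map_inv₀, map_pow, sigma_zeta p hζ, mul_pow, inv_pow, map_natCast]
    ring
  rw [Finset.sum_congr rfl fun c _ => key c, Finset.sum_comm]
  simp_rw [← Finset.mul_sum, Finset.sum_sub_distrib]
  rw [Finset.sum_eq_single (1 : G p)]
  · have h1 : (ζ ^ ((1 : G p) : ZMod p).val)⁻¹ * ζ = 1 := by
      have : Fact (1 < p) := ⟨hp.one_lt⟩
      rw [Units.val_one, ZMod.val_one, pow_one, inv_mul_cancel₀ hζ0]
    have h2 : sigma p K 1 x = x := by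
      rw [sigma, map_one, AlgEquiv.one_apply]
    rw [h1, h2, sum_units_pow (one_pow p), sum_units_pow hζ.pow_eq_one, if_pos rfl, if_neg hζ1]
    field_simp
    ring
  · intro d _ hd
    have h1 : (ζ ^ (d : ZMod p).val)⁻¹ * ζ ≠ 1 := by
      intro h
      apply hd
      have h3 : ζ ^ (d : ZMod p).val = ζ ^ 1 := by
        rw [pow_one]
        exact (inv_mul_eq_one₀ (pow_ne_zero _ hζ0)).1 h
      have h4 := hζ.pow_inj (ZMod.val_lt _) hp.one_lt h3
      apply Units.ext
      have : Fact (1 < p) := ⟨hp.one_lt⟩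
      apply ZMod.val_injective p
      rw [h4, Units.val_one, ZMod.val_one]
    have h2 : ((ζ ^ (d : ZMod p).val)⁻¹ * ζ) ^ p = 1 := by
      rw [mul_pow, inv_pow, ← pow_mul, mul_comm _ p, pow_mul, hζ.pow_eq_one]
      simp
    rw [sum_units_pow h2, sum_units_pow hζ.pow_eq_one, if_neg h1, if_neg hζ1]
    ring
  · intro h
    exact absurd (Finset.mem_univ _) h

/-- These coefficients are unique. -/
theorem coord_unique {ζ : K} (hζ : IsPrimitiveRoot ζ p) (x : K) (w : G p → ℚ)
    (hx : x = ∑ c : G p, algebraMap ℚ K (w c) * ζ ^ (c : ZMod p).val) (c : G p) :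
    w c = coord p ζ c x := by
  let f : (G p → ℚ) →ₗ[ℚ] K := Fintype.linearCombination ℚ fun c : G p => ζ ^ (c : ZMod p).val
  have hf : ∀ v, f v = ∑ c : G p, algebraMap ℚ K (v c) * ζ ^ (c : ZMod p).val := by
    intro v
    simp [f, Fintype.linearCombination_apply, Algebra.smul_def]
  have hs : Function.Surjective f := fun y => ⟨fun c => coord p ζ c y, by
    rw [hf]
    exact (sum_coord hζ y).symm⟩
  have hd : Module.finrank ℚ (G p → ℚ) = Module.finrank ℚ K := by
    rw [IsCyclotomicExtension.finrank K
      (Polynomial.cyclotomic.irreducible_rat (Nat.Prime.pos (Fact.out : p.Prime))),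
      Module.finrank_fintype_fun_eq_card, ZMod.card_units_eq_totient]
  have hi := (LinearMap.injective_iff_surjective_of_finrank_eq_finrank hd).2 hs
  have : w = fun c => coord p ζ c x := hi (by rw [hf, hf, ← hx]; exact sum_coord hζ x)
  exact congrFun this c

end Field

end BinomialStickelberger

end

noncomputable section

namespace BinomialStickelberger

open scoped BigOperators

section Bernoulli

variable {p : ℕ} [Fact p.Prime]

theorem norm_natCast_eq_one_of_lt {n : ℕ} (h0 : 0 < n) (hn : n < p) : ‖(n : ℚ_[p])‖ = 1 :=
  Padic.norm_natCast_eq_one_iff.2 (Nat.coprime_of_lt_prime h0.ne' hn Fact.out)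

theorem norm_padic_natCast_le_one (n : ℕ) : ‖(n : ℚ_[p])‖ ≤ 1 := by
  simpa using Padic.norm_int_le_one (p := p) n

theorem norm_padic_sub_le_max (x y : ℚ_[p]) : ‖x - y‖ ≤ max ‖x‖ ‖y‖ := by
  rw [sub_eq_add_neg, ← norm_neg y]
  exact IsUltrametricDist.norm_add_le_max _ _

/-- Below `p - 1` the Bernoulli numbers are `p`-integral. -/
theorem norm_bernoulli_le_one (i : ℕ) (hi : i + 1 < p) : ‖((bernoulli i : ℚ) : ℚ_[p])‖ ≤ 1 := by
  induction i using Nat.strong_induction_on with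
  | _ i ih =>
    have h := sum_bernoulli (i + 1)
    rw [Finset.sum_range_succ] at h
    have h2 := congrArg (fun q : ℚ => (q : ℚ_[p])) h
    simp only [Rat.cast_add, Rat.cast_mul, Rat.cast_sum, Rat.cast_natCast] at h2
    have h3 := eq_sub_of_add_eq' h2
    have h4 : ‖(((i + 1).choose i : ℕ) : ℚ_[p]) * ((bernoulli i : ℚ) : ℚ_[p])‖ ≤ 1 := by
      rw [h3]
      refine (norm_padic_sub_le_max _ _).trans (max_le ?_ ?_)
      · split_ifs <;> simp
      · refine IsUltrametricDist.norm_sum_le_of_forall_le_of_nonneg zero_le_one fun j hj => ?_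
        have hj := Finset.mem_range.1 hj
        rw [norm_mul]
        exact mul_le_one₀ (norm_padic_natCast_le_one _) (norm_nonneg _) (ih j hj (by omega))
    rwa [norm_mul, Nat.choose_succ_self_right, norm_natCast_eq_one_of_lt (by omega) hi,
      one_mul] at h4

theorem dvd_num_iff_norm_le (q : ℚ) : (p : ℤ) ∣ q.num ↔ ‖(q : ℚ_[p])‖ ≤ (p : ℝ)⁻¹ := by
  have hp : p.Prime := Fact.out
  have hp1 : ((p : ℝ))⁻¹ < 1 := inv_lt_one_of_one_lt₀ (by exact_mod_cast hp.one_lt)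
  have key := Padic.norm_int_le_pow_iff_dvd (p := p) q.num 1
  have hq : ((q.num : ℤ) : ℚ_[p]) = (q : ℚ_[p]) * ((q.den : ℕ) : ℚ_[p]) := by
    exact_mod_cast congrArg (fun r : ℚ => (r : ℚ_[p])) (Rat.mul_den_eq_num q).symm
  simp only [pow_one, Nat.cast_one, zpow_neg, zpow_one] at key
  constructor
  · intro h
    have hd : ‖((q.den : ℕ) : ℚ_[p])‖ = 1 := by
      refine Padic.norm_natCast_eq_one_iff.2 ((hp.coprime_iff_not_dvd).2 fun hd => ?_)
      have := Nat.dvd_gcd (Int.natCast_dvd.1 h) hd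
      rw [q.reduced] at this
      exact hp.one_lt.ne' (Nat.dvd_one.1 this)
    have h2 := key.2 h
    rwa [hq, norm_mul, hd, mul_one] at h2
  · intro h
    refine key.1 ?_
    rw [hq, norm_mul]
    calc _ ≤ (p : ℝ)⁻¹ * 1 := mul_le_mul h (norm_padic_natCast_le_one _) (norm_nonneg _)
          (by positivity)
      _ = _ := mul_one _

theorem not_dvd_num_bernoulli_pred : ¬ (p : ℤ) ∣ (bernoulli (p - 1)).num := by
  have hp : p.Prime := Fact.out
  have hp1 : ((p : ℝ))⁻¹ < 1 := inv_lt_one_of_one_lt₀ (by exact_mod_cast hp.one_lt)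
  intro h
  rw [dvd_num_iff_norm_le] at h
  have hB : ∀ i < p, ‖((bernoulli i : ℚ) : ℚ_[p])‖ ≤ 1 := by
    intro i hi
    rcases lt_or_ge (i + 1) p with h1 | h1
    · exact norm_bernoulli_le_one i h1
    · rw [show i = p - 1 by omega]
      exact h.trans hp1.le
  have hs := sum_bernoulli p
  rw [if_neg hp.one_lt.ne', ← Finset.sum_erase_add _ _ (Finset.mem_range.2 hp.pos)] at hs
  have h2 := congrArg (fun q : ℚ => (q : ℚ_[p])) hs
  simp only [Rat.cast_add, Rat.cast_mul, Rat.cast_sum, Rat.cast_natCast, Nat.choose_zero_right,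
    bernoulli_zero, Rat.cast_one, Rat.cast_zero, Nat.cast_one, mul_one] at h2
  have h3 := eq_neg_of_add_eq_zero_left h2
  have h4 : ‖(-1 : ℚ_[p])‖ ≤ (p : ℝ)⁻¹ := by
    rw [← h3]
    refine IsUltrametricDist.norm_sum_le_of_forall_le_of_nonneg (by positivity) fun j hj => ?_
    obtain ⟨hj0, hj⟩ := Finset.mem_erase.1 hj
    have hj := Finset.mem_range.1 hj
    rw [norm_mul]
    calc _ ≤ (p : ℝ)⁻¹ * 1 := by
          refine mul_le_mul ?_ (hB j hj) (norm_nonneg _) (by positivity)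
          have := (Padic.norm_int_le_pow_iff_dvd (p := p) (p.choose j : ℤ) 1).2
            (by rw [pow_one]; exact_mod_cast hp.dvd_choose_self hj0 hj)
          simpa using this
      _ = _ := mul_one _
  rw [norm_neg, norm_one] at h4
  linarith

/-- For `0 < m < p - 1`, the prime `p` divides the numerator of `B_m` if and only if `p ^ 2` divides
the sum of the `m`-th powers below `p`. -/
theorem dvd_num_bernoulli_iff {m : ℕ} (hm : m + 1 < p) :
    (p : ℤ) ∣ (bernoulli m).num ↔ p ^ 2 ∣ ∑ h ∈ Finset.range p, h ^ m := by
  have hp : p.Prime := Fact.out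
  have hp0 : (0 : ℝ) < p := by exact_mod_cast hp.pos
  have hp1 : ((p : ℝ))⁻¹ ≤ 1 := inv_le_one_of_one_le₀ (by exact_mod_cast hp.one_le)
  have hs := congrArg (fun q : ℚ => (q : ℚ_[p])) (sum_range_pow p m)
  rw [Finset.sum_range_succ] at hs
  simp only [Rat.cast_add, Rat.cast_mul, Rat.cast_sum, Rat.cast_natCast, Rat.cast_pow,
    Rat.cast_div, Rat.cast_one] at hs
  have hm1 : ‖((m : ℚ_[p]) + 1)‖ = 1 := by
    have := norm_natCast_eq_one_of_lt (p := p) (Nat.succ_pos m) hm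
    push_cast at this
    exact this
  have hm0 : ((m : ℚ_[p]) + 1) ≠ 0 := by
    intro h
    rw [h, norm_zero] at hm1
    exact zero_ne_one hm1
  have hlast : ((bernoulli m : ℚ) : ℚ_[p]) * (((m + 1).choose m : ℕ) : ℚ_[p]) *
      (p : ℚ_[p]) ^ (m + 1 - m) / ((m : ℚ_[p]) + 1) = (bernoulli m : ℚ) * p := by
    rw [Nat.choose_succ_self_right, Nat.add_sub_cancel_left, pow_one]
    push_cast
    field_simp
  rw [hlast] at hs
  have hpn : ‖(p : ℚ_[p])‖ = (p : ℝ)⁻¹ := Padic.norm_p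
  have hrest : ‖∑ i ∈ Finset.range m, ((bernoulli i : ℚ) : ℚ_[p]) *
      (((m + 1).choose i : ℕ) : ℚ_[p]) * (p : ℚ_[p]) ^ (m + 1 - i) / ((m : ℚ_[p]) + 1)‖
      ≤ (p : ℝ)⁻¹ ^ 2 := by
    refine IsUltrametricDist.norm_sum_le_of_forall_le_of_nonneg (by positivity) fun i hi => ?_
    have hi := Finset.mem_range.1 hi
    rw [norm_div, hm1, div_one, norm_mul, norm_mul, norm_pow, hpn]
    calc _ ≤ 1 * 1 * (p : ℝ)⁻¹ ^ 2 := by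
          refine mul_le_mul (mul_le_mul (norm_bernoulli_le_one i (by omega))
            (norm_padic_natCast_le_one _) (norm_nonneg _) zero_le_one)
            (pow_le_pow_of_le_one (by positivity) hp1 (by omega)) (by positivity) (by norm_num)
      _ = _ := by ring
  have hdvd : p ^ 2 ∣ ∑ h ∈ Finset.range p, h ^ m ↔
      ‖∑ k ∈ Finset.range p, ((k : ℕ) : ℚ_[p]) ^ m‖ ≤ (p : ℝ)⁻¹ ^ 2 := by
    have := Padic.norm_int_le_pow_iff_dvd (p := p) ((∑ h ∈ Finset.range p, h ^ m : ℕ) : ℤ) 2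
    rw [show (p : ℝ) ^ (-((2 : ℕ) : ℤ)) = (p : ℝ)⁻¹ ^ 2 by
      rw [zpow_neg, zpow_natCast, inv_pow]] at this
    have h2 : (p ^ 2 ∣ ∑ h ∈ Finset.range p, h ^ m) ↔
        ((p : ℤ) ^ 2 ∣ ((∑ h ∈ Finset.range p, h ^ m : ℕ) : ℤ)) := by
      rw [← Int.natCast_dvd_natCast]
      push_cast
      rfl
    rw [h2, ← this]
    push_cast
    rfl
  rw [dvd_num_iff_norm_le, hdvd, hs]
  have hB : ‖((bernoulli m : ℚ) : ℚ_[p])‖ ≤ (p : ℝ)⁻¹ ↔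
      ‖((bernoulli m : ℚ) : ℚ_[p]) * p‖ ≤ (p : ℝ)⁻¹ ^ 2 := by
    rw [norm_mul, hpn, pow_two, mul_le_mul_iff_left₀ (inv_pos.2 hp0)]
  rw [hB]
  constructor
  · intro h
    exact (IsUltrametricDist.norm_add_le_max _ _).trans (max_le hrest h)
  · intro h
    have := (norm_padic_sub_le_max _ _).trans (max_le h hrest)
    rwa [add_sub_cancel_left] at this

end Bernoulli

section Teichmuller

variable (p : ℕ) [Fact p.Prime]

/-- The Teichmüller representative modulo `p ^ 2` of a unit modulo `p`. -/
def teich : G p →* ZMod (p ^ 2) where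
  toFun c := (((c : ZMod p).val : ℕ) : ZMod (p ^ 2)) ^ p
  map_one' := by
    have : Fact (1 < p) := ⟨(Fact.out : p.Prime).one_lt⟩
    simp [ZMod.val_one]
  map_mul' a b := by
    have h : (p : ℤ) ∣ (((a * b : G p) : ZMod p).val : ℤ) -
        ((a : ZMod p).val : ℤ) * ((b : ZMod p).val : ℤ) := by
      rw [← ZMod.intCast_zmod_eq_zero_iff_dvd]
      push_cast
      simp
    have h2 := dvd_sub_pow_of_dvd_sub h 1
    have h3 := (ZMod.intCast_zmod_eq_zero_iff_dvd _ (p ^ 2)).2 (by exact_mod_cast h2)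
    push_cast at h3
    rw [pow_one, sub_eq_zero] at h3
    rw [← mul_pow, ← h3, Units.val_mul]

/-- The reduction modulo `p`. -/
abbrev redMod : ZMod (p ^ 2) →+* ZMod p := ZMod.castHom (dvd_pow_self p two_ne_zero) (ZMod p)

theorem redMod_teich (c : G p) : redMod p (teich p c) = c := by
  change redMod p ((((c : ZMod p).val : ℕ) : ZMod (p ^ 2)) ^ p) = c
  rw [map_pow, map_natCast, ZMod.natCast_zmod_val, ZMod.pow_card]

theorem isUnit_of_redMod_ne_zero {x : ZMod (p ^ 2)} (h : redMod p x ≠ 0) : IsUnit x := by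
  have hp : p.Prime := Fact.out
  obtain ⟨n, rfl⟩ := ZMod.natCast_zmod_surjective x
  rw [ZMod.isUnit_iff_coprime]
  rw [map_natCast, Ne, ZMod.natCast_eq_zero_iff] at h
  exact ((hp.coprime_iff_not_dvd).2 h).symm.pow_right 2

theorem natCast_mul_eq_zero_iff {x : ZMod (p ^ 2)} :
    (p : ZMod (p ^ 2)) * x = 0 ↔ redMod p x = 0 := by
  have hp : p.Prime := Fact.out
  obtain ⟨n, rfl⟩ := ZMod.natCast_zmod_surjective x
  rw [map_natCast, ZMod.natCast_eq_zero_iff, ← Nat.cast_mul, ZMod.natCast_eq_zero_iff, pow_two]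
  exact Nat.mul_dvd_mul_iff_left hp.pos

theorem pow_succ_add_of_mul_self_eq_zero {R : Type*} [CommRing R] {h d : R} (hd : d * d = 0)
    (n : ℕ) : (h + d) ^ (n + 1) = h ^ (n + 1) + (n + 1) * h ^ n * d := by
  induction n with
  | zero => simp
  | succ n ih =>
    rw [pow_succ, ih]
    push_cast
    linear_combination ((n : R) + 1) * h ^ n * hd

variable {p}

theorem sum_teich_pow_eq_zero {m : ℕ} (hm : 0 < m) (hm1 : m + 1 < p) :
    ∑ c : G p, teich p c ^ m = 0 := by
  obtain ⟨g, hg⟩ := IsCyclic.exists_generator (α := G p)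
  have hg1 : (g : ZMod p) ^ m ≠ 1 := by
    intro h
    have h1 : g ^ m = 1 := Units.ext (by simpa using h)
    have h2 := orderOf_dvd_of_pow_eq_one h1
    rw [orderOf_eq_card_of_forall_mem_zpowers hg, Nat.card_eq_fintype_card,
      ZMod.card_units_eq_totient, Nat.totient_prime Fact.out] at h2
    have := Nat.le_of_dvd hm h2
    omega
  have h1 : teich p g ^ m * ∑ c : G p, teich p c ^ m = ∑ c : G p, teich p c ^ m := by
    rw [Finset.mul_sum]
    simp_rw [← mul_pow, ← map_mul]
    exact Equiv.sum_comp (Equiv.mulLeft g) fun c => teich p c ^ m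
  have h2 : IsUnit (teich p g ^ m - 1) := by
    apply isUnit_of_redMod_ne_zero
    rw [map_sub, map_pow, redMod_teich, map_one]
    exact sub_ne_zero.2 hg1
  exact h2.mul_right_eq_zero.1 (by rw [sub_mul, h1, one_mul, sub_self])

theorem sum_units_val {M : Type*} [AddCommMonoid M] (f : ℕ → M) (h0 : f 0 = 0) :
    ∑ c : G p, f (c : ZMod p).val = ∑ h ∈ Finset.range p, f h := by
  rw [← Finset.sum_erase _ h0]
  refine Finset.sum_bij (fun c _ => (c : ZMod p).val) ?_ ?_ ?_ ?_
  · intro c _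
    simp [ZMod.val_lt]
  · intro a _ b _ h
    exact Units.ext (ZMod.val_injective p h)
  · intro b hb
    obtain ⟨hb0, hb⟩ := Finset.mem_erase.1 hb
    have hb := ZMod.val_cast_of_lt (Finset.mem_range.1 hb)
    exact ⟨Units.mk0 (b : ZMod p) fun h => hb0 (by rw [← hb, h, ZMod.val_zero]),
      Finset.mem_univ _, hb⟩
  · intro c _
    rfl

/-- The value modulo `p ^ 2` of `∑_c c ω(c)^n` governs the divisibility of `B_{n+1}` by `p`. -/
theorem dvd_num_bernoulli_iff_sum_teich {n : ℕ} (hn : n + 2 < p) :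
    (p : ℤ) ∣ (bernoulli (n + 1)).num ↔
      ∑ c : G p, (((c : ZMod p).val : ℕ) : ZMod (p ^ 2)) * teich p c ^ n = 0 := by
  have key : ∀ c : G p, ((n + 1 : ℕ) : ZMod (p ^ 2)) *
      ((((c : ZMod p).val : ℕ) : ZMod (p ^ 2)) * teich p c ^ n) =
      ((((c : ZMod p).val ^ (n + 1) : ℕ)) : ZMod (p ^ 2)) + n * teich p c ^ (n + 1) := by
    intro c
    set h : ZMod (p ^ 2) := (((c : ZMod p).val : ℕ) : ZMod (p ^ 2)) with hh
    obtain ⟨d, hd⟩ : ∃ d, teich p c = h + d := ⟨teich p c - h, by ring⟩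
    have hd0 : redMod p d = 0 := by
      have h1 := congrArg (redMod p) hd
      rw [map_add, redMod_teich, hh, map_natCast, ZMod.natCast_zmod_val] at h1
      simpa using h1.symm
    have hdd : d * d = 0 := by
      obtain ⟨k, rfl⟩ := ZMod.natCast_zmod_surjective d
      rw [map_natCast, ZMod.natCast_eq_zero_iff] at hd0
      rw [← Nat.cast_mul, ZMod.natCast_eq_zero_iff, pow_two]
      exact mul_dvd_mul hd0 hd0
    have h1 := pow_succ_add_of_mul_self_eq_zero (h := h) hdd n
    rw [← hd] at h1
    have hth : teich p c ^ n * h = teich p c ^ (n + 1) - teich p c ^ n * d := by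
      linear_combination (-(teich p c ^ n)) * hd
    have hnd : teich p c ^ n * d = h ^ n * d := by
      cases n with
      | zero => simp
      | succ n =>
        rw [hd, pow_succ_add_of_mul_self_eq_zero hdd]
        linear_combination (n + 1) * h ^ n * hdd
    rw [Nat.cast_pow, ← hh]
    push_cast
    linear_combination ((n : ZMod (p ^ 2)) + 1) * hth - (n + 1) * hnd + h1
  have hsum := Finset.sum_congr (rfl : (Finset.univ : Finset (G p)) = _) fun c _ => key c
  rw [← Finset.mul_sum, Finset.sum_add_distrib, ← Finset.mul_sum,
    sum_teich_pow_eq_zero (Nat.succ_pos n) hn, mul_zero, add_zero,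
    sum_units_val (fun h => ((h ^ (n + 1) : ℕ) : ZMod (p ^ 2))) (by simp), ← Nat.cast_sum] at hsum
  rw [dvd_num_bernoulli_iff hn, ← ZMod.natCast_eq_zero_iff, ← hsum]
  have hu : IsUnit ((n + 1 : ℕ) : ZMod (p ^ 2)) := by
    rw [ZMod.isUnit_iff_coprime]
    exact ((Nat.coprime_of_lt_prime (Nat.succ_ne_zero n) (by omega) Fact.out).symm).pow_right 2
  exact hu.mul_right_eq_zero

end Teichmuller

section Characters

variable {p : ℕ}

theorem mem_span_natCast_iff (x : ZG p) :
    x ∈ Ideal.span {((p : ℕ) : ZG p)} ↔ ∀ g, (p : ℤ) ∣ x.coeff g := by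
  rw [Ideal.mem_span_singleton]
  constructor
  · rintro ⟨y, rfl⟩ g
    rw [← nsmul_eq_mul, MonoidAlgebra.coeff_smul_apply, nsmul_eq_mul]
    exact dvd_mul_right _ _
  · intro h
    choose q hq using h
    refine ⟨MonoidAlgebra.ofCoeff (Finsupp.equivFunOnFinite.symm q), ?_⟩
    ext g
    rw [← nsmul_eq_mul, MonoidAlgebra.coeff_smul_apply, nsmul_eq_mul, hq]
    rfl

theorem toQG_injective : Function.Injective (toQG p) := by
  intro x y h
  ext g
  have h1 := congrArg (fun z : QG p => z.coeff g) h
  simpa [toQG] using h1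

variable [Fact p.Prime]

theorem lift_eq_sum {R : Type*} [CommRing R] (F : G p →* R) (x : ZG p) :
    MonoidAlgebra.lift ℤ R (G p) F x = ∑ g : G p, (x.coeff g : R) * F g := by
  rw [MonoidAlgebra.lift_apply, Finsupp.sum_fintype _ _ (by simp)]
  simp

variable (p) in
/-- The character `σ_c ↦ c ^ k` of `ℤ[G]` with values in `ℤ/p`. -/
def chi (k : ℕ) : ZG p →ₐ[ℤ] ZMod p :=
  MonoidAlgebra.lift ℤ (ZMod p) (G p) ((Units.coeHom (ZMod p)).comp (powMonoidHom k))

variable (p) in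
/-- The Teichmüller lift of `chi p k` modulo `p ^ 2`. -/
def chiTeich (k : ℕ) : ZG p →ₐ[ℤ] ZMod (p ^ 2) :=
  MonoidAlgebra.lift ℤ (ZMod (p ^ 2)) (G p) ((teich p).comp (powMonoidHom k))

theorem chi_apply (k : ℕ) (x : ZG p) :
    chi p k x = ∑ g : G p, (x.coeff g : ZMod p) * (g : ZMod p) ^ k := by
  rw [chi, lift_eq_sum]
  simp

theorem chiTeich_apply (k : ℕ) (x : ZG p) :
    chiTeich p k x = ∑ g : G p, (x.coeff g : ZMod (p ^ 2)) * teich p g ^ k := by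
  rw [chiTeich, lift_eq_sum]
  simp

theorem redMod_chiTeich (k : ℕ) (x : ZG p) : redMod p (chiTeich p k x) = chi p k x := by
  rw [chi_apply, chiTeich_apply, map_sum]
  refine Finset.sum_congr rfl fun g _ => ?_
  rw [map_mul, map_intCast, map_pow, redMod_teich]

theorem chi_sig (k : ℕ) (c : G p) : chi p k (sig p c) = (c : ZMod p) ^ k := by
  simp [chi, sig]

theorem chiTeich_sig (k : ℕ) (c : G p) : chiTeich p k (sig p c) = teich p c ^ k := by
  simp [chiTeich, sig]

theorem sum_units_zmod_pow (i : ℕ) :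
    ∑ c : G p, (c : ZMod p) ^ i = if p - 1 ∣ i then -1 else 0 := by
  have := FiniteField.sum_pow_units (ZMod p) i
  rwa [ZMod.card] at this

theorem sum_range_unit_pow {u : ZMod p} (hu : u ^ (p - 1) = 1) :
    ∑ k ∈ Finset.range (p - 1), u ^ k = if u = 1 then -1 else 0 := by
  split_ifs with h
  · subst h
    have h1 : 1 ≤ p := (Fact.out : p.Prime).one_le
    simp [Nat.cast_sub h1]
  · have := geom_sum_eq h (p - 1)
    rw [this, hu, sub_self, zero_div]

/-- An element of `ℤ[G]` is divisible by `p` if and only if all the characters of `ℤ[G]` with values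
in `ℤ/p` vanish on it. -/
theorem mem_span_natCast_iff_chi (x : ZG p) :
    x ∈ Ideal.span {((p : ℕ) : ZG p)} ↔ ∀ k < p - 1, chi p k x = 0 := by
  constructor
  · intro h k _
    obtain ⟨y, rfl⟩ := Ideal.mem_span_singleton.1 h
    rw [map_mul, map_natCast, ZMod.natCast_self, zero_mul]
  · intro h
    rw [mem_span_natCast_iff]
    intro g
    rw [← ZMod.intCast_zmod_eq_zero_iff_dvd]
    have h1 : ∑ k ∈ Finset.range (p - 1), ((g⁻¹ : G p) : ZMod p) ^ k * chi p k x = 0 :=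
      Finset.sum_eq_zero fun k hk => by rw [h k (Finset.mem_range.1 hk), mul_zero]
    simp_rw [chi_apply, Finset.mul_sum] at h1
    rw [Finset.sum_comm] at h1
    have h2 : ∀ c : G p, ∑ k ∈ Finset.range (p - 1),
        ((g⁻¹ : G p) : ZMod p) ^ k * ((x.coeff c : ZMod p) * (c : ZMod p) ^ k) =
        if c = g then -(x.coeff c : ZMod p) else 0 := by
      intro c
      have h3 : ∀ k, ((g⁻¹ : G p) : ZMod p) ^ k * ((x.coeff c : ZMod p) * (c : ZMod p) ^ k) =
          (x.coeff c : ZMod p) * ((g⁻¹ * c : G p) : ZMod p) ^ k := by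
        intro k
        rw [Units.val_mul, mul_pow]
        ring
      simp_rw [h3]
      rw [← Finset.mul_sum, sum_range_unit_pow (ZMod.pow_card_sub_one_eq_one (Units.ne_zero _))]
      have h4 : ((g⁻¹ * c : G p) : ZMod p) = 1 ↔ c = g := by
        rw [Units.val_eq_one, inv_mul_eq_one, eq_comm]
      simp only [h4]
      split_ifs <;> simp
    simp_rw [h2] at h1
    simpa using h1

variable (p) in
/-- A lift to `ℤ[G]` of the idempotent of `(ℤ/p)[G]` that belongs to the character `chi p k`. -/
def idemLift (k : ℕ) : ZG p :=
  -∑ c : G p, (((c⁻¹ : G p) : ZMod p) ^ k).val • sig p c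

theorem chi_idemLift {k l : ℕ} (hk : k < p - 1) (hl : l < p - 1) :
    chi p l (idemLift p k) = if l = k then 1 else 0 := by
  rw [idemLift, map_neg, map_sum]
  have h1 : ∀ c : G p, chi p l ((((c⁻¹ : G p) : ZMod p) ^ k).val • sig p c) =
      (c : ZMod p) ^ (p - 1 - k + l) := by
    intro c
    have h2 : ((c⁻¹ : G p) : ZMod p) ^ k = (c : ZMod p) ^ (p - 1 - k) := by
      have h3 : c ^ (p - 1) = 1 := ZMod.units_pow_card_sub_one_eq_one p c
      have h4 : (c⁻¹) ^ k = c ^ (p - 1 - k) := by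
        rw [inv_pow, inv_eq_iff_mul_eq_one, ← pow_add, show k + (p - 1 - k) = p - 1 by omega, h3]
      have h5 := congrArg Units.val h4
      rwa [Units.val_pow_eq_pow_val, Units.val_pow_eq_pow_val] at h5
    rw [map_nsmul, chi_sig, nsmul_eq_mul, ZMod.natCast_zmod_val, h2, pow_add]
  simp_rw [h1]
  rw [sum_units_zmod_pow]
  have h5 : p - 1 ∣ p - 1 - k + l ↔ l = k := by
    constructor
    · rintro ⟨q, hq⟩
      rcases q with _ | _ | q
      · omega
      · omega
      · have : (p - 1) * (q + 1 + 1) = (p - 1) * q + (p - 1) + (p - 1) := by ring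
        have := Nat.zero_le ((p - 1) * q)
        omega
    · rintro rfl
      rw [show p - 1 - l + l = p - 1 by omega]
  simp only [h5]
  split_ifs <;> simp

variable (p) in
/-- The element `∑_c c σ_c⁻¹ = p ϑ` of `ℤ[G]`. -/
def stick : ZG p := ∑ c : G p, (c : ZMod p).val • sig p c⁻¹

theorem toQG_stick : toQG p (stick p) = (p : QG p) * stickelbergerElement p := by
  have hp : (p : ℚ) ≠ 0 := Nat.cast_ne_zero.2 (Fact.out : p.Prime).ne_zero
  rw [stick, stickelbergerElement, map_sum, Finset.mul_sum]
  refine Finset.sum_congr rfl fun c _ => ?_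
  rw [map_nsmul, ← nsmul_eq_mul, sig, toQG, MonoidAlgebra.mapRingHom_single,
    MonoidAlgebra.smul_single, MonoidAlgebra.smul_single]
  congr 1
  simp only [nsmul_eq_mul, map_one, mul_one]
  field_simp

theorem mem_stickelbergerIdeal_iff (x : ZG p) :
    x ∈ stickelbergerIdeal p ↔ ∃ y : ZG p, (p : ZG p) * x = stick p * y := by
  have hp : IsUnit (p : QG p) := by
    have h := (IsUnit.mk0 (p : ℚ) (Nat.cast_ne_zero.2 (Fact.out : p.Prime).ne_zero)).map
      (algebraMap ℚ (QG p))
    rwa [map_natCast] at h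
  have h1 : ∀ y : ZG p, toQG p x = stickelbergerElement p * toQG p y ↔
      (p : ZG p) * x = stick p * y := by
    intro y
    rw [← toQG_injective.eq_iff, map_mul, map_mul, map_natCast, toQG_stick, mul_assoc,
      hp.mul_right_inj]
  exact exists_congr h1

theorem stick_mem : stick p ∈ stickelbergerIdeal p :=
  (mem_stickelbergerIdeal_iff _).2 ⟨p, mul_comm _ _⟩

theorem chi_stick (k : ℕ) :
    chi p k (stick p) = ∑ c : G p, (c : ZMod p) * ((c⁻¹ : G p) : ZMod p) ^ k := by
  rw [stick, map_sum]
  refine Finset.sum_congr rfl fun c _ => ?_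
  rw [map_nsmul, chi_sig, nsmul_eq_mul, ZMod.natCast_zmod_val]

theorem chi_one_stick : chi p 1 (stick p) = -1 := by
  rw [chi_stick, Finset.sum_congr rfl fun c _ => show _ = (1 : ZMod p) by rw [pow_one, Units.mul_inv]]
  have := sum_units_zmod_pow (p := p) 0
  simpa using this

/-- The elements `(b - σ_b) ϑ` are integral. -/
theorem exists_mem_stickelbergerIdeal (b : G p) : ∃ x ∈ stickelbergerIdeal p,
    (p : ZG p) * x = stick p * (((b : ZMod p).val : ZG p) - sig p b) := by
  have h : stick p * (((b : ZMod p).val : ZG p) - sig p b) ∈ Ideal.span {((p : ℕ) : ZG p)} := by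
    rw [mem_span_natCast_iff_chi]
    intro k _
    rw [map_mul, map_sub, map_natCast, chi_sig, ZMod.natCast_zmod_val, mul_sub, sub_eq_zero,
      chi_stick, Finset.sum_mul, Finset.sum_mul]
    conv_rhs => rw [← Equiv.sum_comp (Equiv.mulRight b)]
    refine Finset.sum_congr rfl fun c _ => ?_
    simp only [Equiv.coe_mulRight, mul_inv, Units.val_mul]
    have h1 : ((b⁻¹ : G p) : ZMod p) ^ k * (b : ZMod p) ^ k = 1 := by
      rw [← mul_pow, ← Units.val_mul, inv_mul_cancel, Units.val_one, one_pow]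
    rw [mul_pow]
    linear_combination (c : ZMod p) * (b : ZMod p) * ((c⁻¹ : G p) : ZMod p) ^ k * (-h1)
  obtain ⟨x, hx⟩ := Ideal.mem_span_singleton.1 h
  exact ⟨x, (mem_stickelbergerIdeal_iff _).2 ⟨_, hx.symm⟩, hx.symm⟩

theorem chiTeich_stick {k : ℕ} (hk : k ≤ p - 1) : chiTeich p k (stick p) =
    ∑ c : G p, (((c : ZMod p).val : ℕ) : ZMod (p ^ 2)) * teich p c ^ (p - 1 - k) := by
  rw [stick, map_sum]
  refine Finset.sum_congr rfl fun c _ => ?_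
  rw [map_nsmul, chiTeich_sig, nsmul_eq_mul, ← map_pow, ← map_pow]
  congr 2
  rw [inv_pow, inv_eq_iff_mul_eq_one, ← pow_add, show k + (p - 1 - k) = p - 1 by omega,
    ZMod.units_pow_card_sub_one_eq_one]

theorem exists_unit_pow_ne {k : ℕ} (hk1 : 1 < k) (hk : k < p - 1) :
    ∃ b : G p, (b : ZMod p) ^ k ≠ b := by
  obtain ⟨g, hg⟩ := IsCyclic.exists_generator (α := G p)
  refine ⟨g, fun h => ?_⟩
  have h1 : g ^ (k - 1) = 1 := by
    have h2 : g ^ (k - 1) * g = 1 * g := by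
      rw [← pow_succ, Nat.sub_add_cancel hk1.le, one_mul]
      exact Units.ext (by simpa using h)
    exact mul_right_cancel h2
  have h2 := orderOf_dvd_of_pow_eq_one h1
  rw [orderOf_eq_card_of_forall_mem_zpowers hg, Nat.card_eq_fintype_card,
    ZMod.card_units_eq_totient, Nat.totient_prime Fact.out] at h2
  have := Nat.le_of_dvd (by omega) h2
  omega

/-- The character `chi p k` is nonzero on the Stickelberger ideal if and only if `p` does not divide
the numerator of `B_{p-k}`. -/
theorem exists_chi_ne_zero_iff {k : ℕ} (hk0 : 0 < k) (hk : k < p - 1) :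
    (∃ x ∈ stickelbergerIdeal p, chi p k x ≠ 0) ↔ ¬ (p : ℤ) ∣ (bernoulli (p - k)).num := by
  rcases Nat.lt_or_ge 1 k with hk1 | hk1
  · have hB := dvd_num_bernoulli_iff_sum_teich (p := p) (n := p - 1 - k) (by omega)
    rw [← chiTeich_stick hk.le, show p - 1 - k + 1 = p - k by omega] at hB
    rw [hB]
    constructor
    · rintro ⟨x, hx, hx0⟩ h
      obtain ⟨y, hy⟩ := (mem_stickelbergerIdeal_iff x).1 hx
      have h1 := congrArg (chiTeich p k) hy
      rw [map_mul, map_mul, h, zero_mul, map_natCast, natCast_mul_eq_zero_iff,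
        redMod_chiTeich] at h1
      exact hx0 h1
    · intro h
      obtain ⟨b, hb⟩ := exists_unit_pow_ne hk1 hk
      obtain ⟨x, hx, hxb⟩ := exists_mem_stickelbergerIdeal b
      refine ⟨x, hx, fun h0 => h ?_⟩
      have h1 := congrArg (chiTeich p k) hxb
      rw [map_mul, map_mul, map_natCast,
        (natCast_mul_eq_zero_iff p).2 (by rw [redMod_chiTeich, h0])] at h1
      have hu : IsUnit (chiTeich p k (((b : ZMod p).val : ZG p) - sig p b)) := by
        apply isUnit_of_redMod_ne_zero
        rw [redMod_chiTeich, map_sub, map_natCast, chi_sig, ZMod.natCast_zmod_val]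
        exact sub_ne_zero.2 hb.symm
      exact hu.mul_left_eq_zero.1 h1.symm
  · obtain rfl : k = 1 := by omega
    refine iff_of_true ⟨stick p, stick_mem, ?_⟩ not_dvd_num_bernoulli_pred
    rw [chi_one_stick]
    exact neg_ne_zero.2 one_ne_zero

theorem mem_minusIdeal_iff (x : ZG p) :
    x ∈ minusIdeal p ↔ ∃ y ∈ stickelbergerIdeal p, (1 - sig p (-1)) * y = x :=
  Ideal.mem_span_singleton_mul

theorem chi_one_sub_sig (k : ℕ) : chi p k (1 - sig p (-1)) = 1 - (-1) ^ k := by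
  rw [map_sub, map_one, chi_sig]
  simp

variable (p) in
/-- The characters that do not vanish on the ideal `𝒯`. -/
def goodChars : Finset ℕ :=
  (Finset.range (p - 1)).filter fun k => Odd k ∧ ¬ (p : ℤ) ∣ (bernoulli (p - k)).num

theorem mem_goodChars_iff (hp : p ≠ 2) (k : ℕ) :
    k ∈ goodChars p ↔ k < p - 1 ∧ ∃ x ∈ minusIdeal p, chi p k x ≠ 0 := by
  rw [goodChars, Finset.mem_filter, Finset.mem_range]
  refine and_congr_right fun hk => ?_
  have h2 : (2 : ZMod p) ≠ 0 := by
    have : ((2 : ℕ) : ZMod p) ≠ 0 := by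
      rw [Ne, ZMod.natCast_eq_zero_iff]
      exact fun h => hp ((Nat.prime_dvd_prime_iff_eq Fact.out Nat.prime_two).1 h)
    exact_mod_cast this
  constructor
  · rintro ⟨ho, hB⟩
    obtain ⟨x, hx, hx0⟩ := (exists_chi_ne_zero_iff ho.pos hk).2 hB
    refine ⟨_, (mem_minusIdeal_iff _).2 ⟨x, hx, rfl⟩, ?_⟩
    rw [map_mul, chi_one_sub_sig, ho.neg_one_pow, sub_neg_eq_add, one_add_one_eq_two]
    exact mul_ne_zero h2 hx0
  · rintro ⟨x, hx, hx0⟩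
    obtain ⟨y, hy, rfl⟩ := (mem_minusIdeal_iff _).1 hx
    rw [map_mul, chi_one_sub_sig] at hx0
    have ho : Odd k := by
      by_contra he
      rw [Nat.not_odd_iff_even] at he
      rw [he.neg_one_pow, sub_self, zero_mul] at hx0
      exact hx0 rfl
    exact ⟨ho, (exists_chi_ne_zero_iff ho.pos hk).1 ⟨y, hy, right_ne_zero_of_mul hx0⟩⟩

theorem cls_eq_cls_iff (x y : minusIdeal p) :
    cls p x = cls p y ↔ ((x : ZG p) - y) ∈ Ideal.span {((p : ℕ) : ZG p)} :=
  Submodule.Quotient.eq _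

theorem cls_surjective : Function.Surjective (cls p) := Submodule.Quotient.mk_surjective _

theorem cls_eq_cls_iff_chi (hp : p ≠ 2) (x y : minusIdeal p) :
    cls p x = cls p y ↔ ∀ k : goodChars p, chi p k (x : ZG p) = chi p k (y : ZG p) := by
  rw [cls_eq_cls_iff, mem_span_natCast_iff_chi]
  constructor
  · rintro h ⟨k, hk⟩
    have := h k ((mem_goodChars_iff hp k).1 hk).1
    rwa [map_sub, sub_eq_zero] at this
  · intro h k hk
    rw [map_sub, sub_eq_zero]
    by_cases hg : k ∈ goodChars p
    · exact h ⟨k, hg⟩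
    · rw [mem_goodChars_iff hp] at hg
      push Not at hg
      rw [hg hk _ x.2, hg hk _ y.2]

theorem exists_chi_eq (hp : p ≠ 2) (v : goodChars p → ZMod p) :
    ∃ x : minusIdeal p, ∀ k : goodChars p, chi p k (x : ZG p) = v k := by
  have h1 : ∀ k : goodChars p, ∃ x ∈ minusIdeal p, ∀ l : goodChars p,
      chi p l x = if l = k then v k else 0 := by
    rintro ⟨k, hk⟩
    obtain ⟨hk1, x, hx, hx0⟩ := (mem_goodChars_iff hp k).1 hk
    refine ⟨(v ⟨k, hk⟩ * (chi p k x)⁻¹).val • (idemLift p k * x),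
      Submodule.smul_of_tower_mem _ _ (Ideal.mul_mem_left _ _ hx), ?_⟩
    rintro ⟨l, hl⟩
    have hl1 := ((mem_goodChars_iff hp l).1 hl).1
    rw [map_nsmul, map_mul, chi_idemLift hk1 hl1, nsmul_eq_mul, ZMod.natCast_zmod_val]
    by_cases h : l = k
    · subst h
      simp [hx0]
    · simp [h]
  choose x hx hxl using h1
  refine ⟨⟨∑ k, x k, Submodule.sum_mem _ fun k _ => hx k⟩, fun l => ?_⟩
  simp [map_sum, hxl]

theorem nat_card_tHat (hp : p ≠ 2) : Nat.card (THat p) = p ^ (goodChars p).card := by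
  have hb : Function.Bijective fun (t : THat p) (k : goodChars p) =>
      chi p k ((Function.surjInv cls_surjective t : minusIdeal p) : ZG p) := by
    constructor
    · intro s t h
      have := (cls_eq_cls_iff_chi hp _ _).2 fun k => congrFun h k
      rwa [Function.surjInv_eq cls_surjective, Function.surjInv_eq cls_surjective] at this
    · intro v
      obtain ⟨x, hx⟩ := exists_chi_eq hp v
      refine ⟨cls p x, funext fun k => ?_⟩
      rw [← hx k]
      exact (cls_eq_cls_iff_chi hp _ _).1 (Function.surjInv_eq _ _) k
  rw [Nat.card_congr (Equiv.ofBijective _ hb)]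
  simp [Nat.card_eq_fintype_card, ZMod.card]

theorem finite_tHat (hp : p ≠ 2) : Finite (THat p) :=
  Nat.finite_of_card_ne_zero (by
    rw [nat_card_tHat hp]
    exact pow_ne_zero _ (Fact.out : p.Prime).ne_zero)

theorem nsmul_tHat_eq_zero (t : THat p) : p • t = 0 := by
  obtain ⟨x, rfl⟩ := cls_surjective t
  change cls p (p • x) = cls p 0
  rw [cls_eq_cls_iff]
  refine Ideal.mem_span_singleton.2 ⟨x, ?_⟩
  simp

theorem card_goodChars_add_irregularityIndex (hp : p ≠ 2) :
    (goodChars p).card + irregularityIndex p = (p - 1) / 2 := by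
  have hodd : Odd p := (Fact.out : p.Prime).odd_of_ne_two hp
  have h1 : (goodChars p).card + irregularityIndex p =
      ((Finset.range (p - 1)).filter fun i => Odd i).card := by
    rw [goodChars, irregularityIndex, ← Finset.filter_filter, ← Finset.filter_filter, add_comm,
      Finset.card_filter_add_card_filter_not]
  rw [h1]
  obtain ⟨m, hm⟩ := hodd
  have h2 : p - 1 = m * 2 := by omega
  rw [h2, Nat.mul_div_cancel _ two_pos]
  have h3 : ∀ n : ℕ, ((Finset.range (n * 2)).filter fun i => Odd i).card = n := by
    intro n
    induction n with
    | zero => simp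
    | succ n ih =>
      rw [show (n + 1) * 2 = n * 2 + 1 + 1 by ring, Finset.range_add_one, Finset.filter_insert,
        if_pos (by exact ⟨n, by ring⟩), Finset.card_insert_of_notMem (by simp),
        Finset.range_add_one, Finset.filter_insert, if_neg (by simp), ih]
  exact h3 m

theorem nonempty_addEquiv_of_card {V : Type*} [AddCommGroup V] [Module (ZMod p) V] [Finite V]
    {D : ℕ} (hV : Nat.card V = p ^ D) : Nonempty ((Fin D → ZMod p) ≃+ V) := by
  have hD : Module.finrank (ZMod p) V = D :=
    Nat.pow_right_injective (Fact.out : p.Prime).two_le (by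
      change p ^ _ = p ^ _
      rw [FiniteField.pow_finrank_eq_natCard, hV])
  obtain ⟨e⟩ : Nonempty ((Fin D → ZMod p) ≃ₗ[ZMod p] V) :=
    FiniteDimensional.nonempty_linearEquiv_of_finrank_eq (by rw [hD, Module.finrank_fin_fun])
  exact ⟨e.toAddEquiv⟩

/-- A finite elementary abelian `p`-group of order `p ^ D` has `p`-rank `D`. -/
theorem hasPRank_of_card {A : Type*} [CommGroup A] {D : ℕ} (hA : Nat.card A = p ^ D)
    (hexp : ∀ a : A, a ^ p = 1) : HasPRank p A D := by
  have hp : p.Prime := Fact.out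
  have hfin : Finite A := Nat.finite_of_card_ne_zero (by
    rw [hA]
    exact pow_ne_zero _ hp.ne_zero)
  constructor
  · let _ : Module (ZMod p) (Additive A) := AddCommGroup.zmodModule fun x => hexp x.toMul
    obtain ⟨e⟩ := nonempty_addEquiv_of_card (V := Additive A) hA
    exact ⟨AddMonoidHom.toMultiplicativeLeft e.toAddMonoidHom, e.injective⟩
  · rintro s ⟨f, hf⟩
    have h1 := Nat.card_le_card_of_injective f hf
    have h2 : Nat.card (Multiplicative (Fin s → ZMod p)) = p ^ s := by
      change Nat.card (Fin s → ZMod p) = p ^ s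
      simp [Nat.card_eq_fintype_card, ZMod.card]
    rw [h2, hA] at h1
    exact (Nat.pow_le_pow_iff_right hp.one_lt).1 h1

theorem hasPRank_tHat (hp : p ≠ 2) :
    HasPRank p (Multiplicative (THat p)) (goodChars p).card :=
  hasPRank_of_card (nat_card_tHat hp) fun t => nsmul_tHat_eq_zero t.toAdd

end Characters

section Radicals

variable {F L : Type*} [Field F] [Field L] [Algebra F L] {p : ℕ} [NeZero p] {η : F}

theorem exists_algebraMap_eq_of_pow_eq_one (hη : IsPrimitiveRoot η p) {y : L} (hy : y ^ p = 1) :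
    ∃ u : F, algebraMap F L u = y := by
  obtain ⟨i, _, hi⟩ := (hη.map_of_injective (algebraMap F L).injective).eq_pow_of_pow_eq_one hy
  exact ⟨η ^ i, by rw [map_pow, hi]⟩

theorem exists_eq_algebraMap_mul (hη : IsPrimitiveRoot η p) {x y : L} (hy : y ≠ 0) {w : F}
    (h : x ^ p = algebraMap F L w ^ p * y ^ p) : ∃ u : F, x = algebraMap F L u * y := by
  by_cases hw : w = 0
  · subst hw
    rw [map_zero, zero_pow (NeZero.ne p), zero_mul] at h
    exact ⟨0, by rw [map_zero, zero_mul]; exact eq_zero_of_pow_eq_zero h⟩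
  have hw' : algebraMap F L w ≠ 0 := (map_ne_zero _).2 hw
  have h1 : (x / (algebraMap F L w * y)) ^ p = 1 := by
    rw [div_pow, mul_pow, h, div_self]
    exact mul_ne_zero (pow_ne_zero _ hw') (pow_ne_zero _ hy)
  obtain ⟨u, hu⟩ := exists_algebraMap_eq_of_pow_eq_one hη h1
  refine ⟨u * w, ?_⟩
  rw [map_mul, hu]
  field_simp

/-- An automorphism multiplies a radical by a root of unity of the base field. -/
theorem exists_apply_eq_mul (hη : IsPrimitiveRoot η p) {x : L} (hx : x ≠ 0) {a : F}
    (hxa : x ^ p = algebraMap F L a) (σ : Gal(L/F)) :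
    ∃ u : F, u ^ p = 1 ∧ σ x = algebraMap F L u * x := by
  have h1 : (σ x / x) ^ p = 1 := by
    rw [div_pow, ← map_pow, hxa, AlgEquiv.commutes, div_self]
    rw [← hxa]
    exact pow_ne_zero _ hx
  obtain ⟨u, hu⟩ := exists_algebraMap_eq_of_pow_eq_one hη h1
  refine ⟨u, ?_, ?_⟩
  · apply (algebraMap F L).injective
    rw [map_pow, hu, h1, map_one]
  · rw [hu, div_mul_cancel₀ _ hx]

/-- The Kummer character `σ ↦ σ x / x` of a radical `x`. -/
def radicalChar (hη : IsPrimitiveRoot η p) (x : L) (hx : x ≠ 0)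
    (hxa : x ^ p ∈ Set.range (algebraMap F L)) : Gal(L/F) →* L where
  toFun σ := σ x / x
  map_one' := by rw [AlgEquiv.one_apply, div_self hx]
  map_mul' σ τ := by
    obtain ⟨a, ha⟩ := hxa
    obtain ⟨u, -, hu⟩ := exists_apply_eq_mul hη hx ha.symm σ
    obtain ⟨v, -, hv⟩ := exists_apply_eq_mul hη hx ha.symm τ
    rw [AlgEquiv.mul_apply, hv, map_mul, AlgEquiv.commutes, hu]
    field_simp

theorem radicalChar_injective [IsGalois F L] (hη : IsPrimitiveRoot η p) {ι : Type*} {x : ι → L}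
    (hx : ∀ i, x i ≠ 0) (hxa : ∀ i, x i ^ p ∈ Set.range (algebraMap F L))
    (hinj : ∀ i j, x i / x j ∈ Set.range (algebraMap F L) → i = j) :
    Function.Injective fun i => radicalChar hη (x i) (hx i) (hxa i) := by
  intro i j h
  refine hinj i j ((InfiniteGalois.mem_range_algebraMap_iff_fixed _).2 fun σ => ?_)
  have h1 : σ (x i) / x i = σ (x j) / x j := DFunLike.congr_fun h σ
  have h2 : σ (x j) ≠ 0 := (map_ne_zero σ).2 (hx j)
  have h3 := hx i
  have h4 := hx j
  rw [map_div₀]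
  field_simp at h1 ⊢
  rw [h1]

/-- Radicals in pairwise distinct Kummer classes are linearly independent: Galois case. -/
theorem linearIndependent_radicals_of_isGalois [IsGalois F L] (hη : IsPrimitiveRoot η p)
    {ι : Type*} {x : ι → L} (hx : ∀ i, x i ≠ 0)
    (hxa : ∀ i, x i ^ p ∈ Set.range (algebraMap F L))
    (hinj : ∀ i j, x i / x j ∈ Set.range (algebraMap F L) → i = j) :
    LinearIndependent F x := by
  have hchar := (linearIndependent_monoidHom Gal(L/F) L).comp _
    (radicalChar_injective hη hx hxa hinj)
  rw [linearIndependent_iff'] at hchar ⊢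
  intro s g hg i hi
  have h1 := hchar s (fun i => algebraMap F L (g i) * x i) (funext fun σ => by
    have h2 := congrArg σ hg
    rw [map_sum, map_zero] at h2
    rw [Finset.sum_apply, Pi.zero_apply, ← h2]
    refine Finset.sum_congr rfl fun j _ => ?_
    have h3 : (radicalChar hη (x j) (hx j) (hxa j)) σ = σ (x j) / x j := rfl
    have h4 := hx j
    rw [Pi.smul_apply, smul_eq_mul, Function.comp_apply, h3, Algebra.smul_def, map_mul,
      AlgEquiv.commutes]
    field_simp) i hi
  exact (map_eq_zero (algebraMap F L)).1 ((mul_eq_zero.1 h1).resolve_right (hx i))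

/-- Radicals in pairwise distinct Kummer classes are linearly independent. -/
theorem linearIndependent_radicals [CharZero F] (hη : IsPrimitiveRoot η p)
    {ι : Type*} {x : ι → L} (hx : ∀ i, x i ≠ 0)
    (hxa : ∀ i, x i ^ p ∈ Set.range (algebraMap F L))
    (hinj : ∀ i j, x i / x j ∈ Set.range (algebraMap F L) → i = j) :
    LinearIndependent F x := by
  have hint : ∀ i, x i ∈ algebraicClosure F L := by
    intro i
    obtain ⟨a, ha⟩ := hxa i
    rw [mem_algebraicClosure_iff']
    refine IsIntegral.of_pow (NeZero.pos p) ?_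
    rw [← ha]
    exact isIntegral_algebraMap
  let E := algebraicClosure F L
  let φ : E →ₐ[F] AlgebraicClosure F := IsAlgClosed.lift
  let y : ι → E := fun i => ⟨x i, hint i⟩
  have hy : ∀ i, y i ≠ 0 := fun i h => hx i (congrArg Subtype.val h)
  have hgal : IsGalois F (AlgebraicClosure F) := ⟨⟩
  have h1 : LinearIndependent F (fun i => φ (y i)) := by
    refine linearIndependent_radicals_of_isGalois hη (fun i => (map_ne_zero φ).2 (hy i)) ?_ ?_
    · intro i
      obtain ⟨a, ha⟩ := hxa i
      refine ⟨a, ?_⟩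
      rw [← map_pow, ← φ.commutes]
      exact congrArg φ (Subtype.ext ha)
    · rintro i j ⟨a, ha⟩
      refine hinj i j ⟨a, ?_⟩
      rw [← map_div₀, ← φ.commutes] at ha
      exact congrArg Subtype.val (φ.injective ha)
  have h2 : LinearIndependent F y := LinearIndependent.of_comp φ.toLinearMap h1
  exact h2.map' E.val.toLinearMap (LinearMap.ker_eq_bot.2 E.val.injective)

/-- A finite Galois group has at least as many elements as there are Kummer classes of radicals. -/
theorem card_le_card_gal [IsGalois F L] [Finite Gal(L/F)] (hη : IsPrimitiveRoot η p)
    {ι : Type*} [Finite ι] {x : ι → L} (hx : ∀ i, x i ≠ 0)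
    (hxa : ∀ i, x i ^ p ∈ Set.range (algebraMap F L))
    (hinj : ∀ i j, x i / x j ∈ Set.range (algebraMap F L) → i = j) :
    Nat.card ι ≤ Nat.card Gal(L/F) := by
  have := Fintype.ofFinite ι
  have := Fintype.ofFinite Gal(L/F)
  have hchar := (linearIndependent_monoidHom Gal(L/F) L).comp _
    (radicalChar_injective hη hx hxa hinj)
  have h1 := hchar.fintype_card_le_finrank
  rwa [Module.finrank_fintype_fun_eq_card, ← Nat.card_eq_fintype_card,
    ← Nat.card_eq_fintype_card] at h1

/-- A family of distinct characters of a finite group is at most as large as the group. -/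
theorem finite_and_card_le_of_monoidHom {M ι : Type*} [MulOneClass M] [Finite M] (f : ι → M →* L)
    (hf : Function.Injective f) : Finite ι ∧ Nat.card ι ≤ Nat.card M := by
  have := Fintype.ofFinite M
  have hlin := (linearIndependent_monoidHom M L).comp f hf
  have hfin : Finite ι := hlin.finite
  have := Fintype.ofFinite ι
  refine ⟨hfin, ?_⟩
  have h1 := hlin.fintype_card_le_finrank
  rwa [Module.finrank_fintype_fun_eq_card, ← Nat.card_eq_fintype_card,
    ← Nat.card_eq_fintype_card] at h1

end Radicals

section LinearFactors

variable {K : Type*} [Field K]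

theorem irreducible_one_sub {a : K} (ha : a ≠ 0) :
    Irreducible (1 - Polynomial.C a * Polynomial.X) := by
  apply Polynomial.irreducible_of_degree_eq_one
  rw [show (1 - Polynomial.C a * Polynomial.X : Polynomial K) =
    Polynomial.C (-a) * Polynomial.X + Polynomial.C 1 by simp; ring]
  exact Polynomial.degree_linear (neg_ne_zero.2 ha)

theorem algebraMap_one_sub (a : K) :
    algebraMap (Polynomial K) (RatFunc K) (1 - Polynomial.C a * Polynomial.X) =
      1 - RatFunc.C a * RatFunc.X := by
  simp

theorem one_sub_ne_zero {a : K} (ha : a ≠ 0) : (1 - RatFunc.C a * RatFunc.X : RatFunc K) ≠ 0 := by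
  rw [← algebraMap_one_sub]
  exact (map_ne_zero_iff _ (RatFunc.algebraMap_injective K)).2 (irreducible_one_sub ha).ne_zero

/-- The exponents of a product of distinct linear factors that is a `p`-th power are divisible
by `p`. -/
theorem dvd_of_prod_eq_pow {ι : Type*} [Fintype ι] {a : ι → K} (ha : ∀ i, a i ≠ 0)
    (hinj : Function.Injective a) (n : ι → ℤ) (p : ℕ) (w : RatFunc K)
    (h : ∏ i, (1 - RatFunc.C (a i) * RatFunc.X) ^ n i = w ^ p) (i : ι) : (p : ℤ) ∣ n i := by
  have hirr := irreducible_one_sub (ha i)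
  let v : IsDedekindDomain.HeightOneSpectrum (Polynomial K) :=
    { asIdeal := Ideal.span {1 - Polynomial.C (a i) * Polynomial.X}
      isPrime := (Ideal.span_singleton_prime hirr.ne_zero).2 hirr.prime
      ne_bot := by
        rw [Ne, Ideal.span_singleton_eq_bot]
        exact hirr.ne_zero }
  have h1 : v.valuation (RatFunc K) (1 - RatFunc.C (a i) * RatFunc.X) =
      WithZero.exp (-1 : ℤ) := by
    rw [← algebraMap_one_sub, v.valuation_of_algebraMap]
    exact v.intValuation_singleton hirr.ne_zero rfl
  have h2 : ∀ j, j ≠ i → v.valuation (RatFunc K) (1 - RatFunc.C (a j) * RatFunc.X) = 1 := by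
    intro j hj
    rw [← algebraMap_one_sub, v.valuation_eq_one_iff_notMem]
    intro hmem
    obtain ⟨q, hq⟩ := Ideal.mem_span_singleton.1 hmem
    have h3 := congrArg (Polynomial.eval (a i)⁻¹) hq
    have h4 := ha i
    simp only [Polynomial.eval_sub, Polynomial.eval_mul, Polynomial.eval_C, Polynomial.eval_X,
      Polynomial.eval_one, mul_inv_cancel₀ h4, sub_self, zero_mul] at h3
    apply hj
    apply hinj
    have h5 := sub_eq_zero.1 h3
    field_simp at h5
    exact h5.symm
  have h3 := congrArg (fun z => WithZero.log (v.valuation (RatFunc K) z)) h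
  simp only [map_prod, map_zpow₀, map_pow] at h3
  rw [Finset.prod_eq_single i (fun j _ hj => by rw [h2 j hj, one_zpow])
    (fun hi => absurd (Finset.mem_univ _) hi), h1, WithZero.log_zpow, WithZero.log_exp,
    WithZero.log_pow] at h3
  refine ⟨-WithZero.log (v.valuation (RatFunc K) w), ?_⟩
  simp only [smul_eq_mul, nsmul_eq_mul] at h3
  linarith

end LinearFactors

section Kummer

variable {p : ℕ} {K : Type*} [Field K] {ζ : K}

theorem isPrimitiveRoot_ratFunc (hζ : IsPrimitiveRoot ζ p) :
    IsPrimitiveRoot (RatFunc.C ζ : RatFunc K) p :=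
  hζ.map_of_injective (RatFunc.C (K := K)).injective

variable [Fact p.Prime]

theorem zeta_pow_val_injective (hζ : IsPrimitiveRoot ζ p) :
    Function.Injective fun c : G p => ζ ^ (c : ZMod p).val := fun _ _ h =>
  Units.ext (ZMod.val_injective p (hζ.pow_inj (ZMod.val_lt _) (ZMod.val_lt _) h))

variable [NumberField K]

theorem mu_ne_zero (hζ : IsPrimitiveRoot ζ p) : mu p ζ ≠ 0 := by
  have hp : p.Prime := Fact.out
  exact div_ne_zero (pow_ne_zero _ (Nat.cast_ne_zero.2 hp.ne_zero))
    (sub_ne_zero.2 (hζ.ne_one hp.one_lt).symm)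

variable [IsCyclotomicExtension {p} ℚ K]

theorem sigma_mu_ne_zero (hζ : IsPrimitiveRoot ζ p) (c : G p) : sigma p K c (mu p ζ) ≠ 0 :=
  (map_ne_zero _).2 (mu_ne_zero hζ)

theorem sigma_mu_injective (hζ : IsPrimitiveRoot ζ p) :
    Function.Injective fun c : G p => sigma p K c (mu p ζ) := by
  have hp0 : (p : K) ^ 2 ≠ 0 := pow_ne_zero _ (Nat.cast_ne_zero.2 (Fact.out : p.Prime).ne_zero)
  intro c d h
  apply zeta_pow_val_injective hζ
  simp only [mu, map_div₀, map_pow, map_natCast, map_sub, map_one, sigma_zeta p hζ] at h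
  rw [div_eq_mul_inv, div_eq_mul_inv, mul_right_inj' hp0, inv_inj] at h
  exact sub_right_injective h

theorem kummerElt_ne_zero (hζ : IsPrimitiveRoot ζ p) (θ : ZG p) : kummerElt p ζ θ ≠ 0 :=
  Finset.prod_ne_zero_iff.2 fun c _ => zpow_ne_zero _ (one_sub_ne_zero (sigma_mu_ne_zero hζ c))

theorem kummerElt_add (hζ : IsPrimitiveRoot ζ p) (θ θ' : ZG p) :
    kummerElt p ζ (θ + θ') = kummerElt p ζ θ * kummerElt p ζ θ' := by
  rw [kummerElt, kummerElt, kummerElt, ← Finset.prod_mul_distrib]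
  refine Finset.prod_congr rfl fun c _ => ?_
  rw [MonoidAlgebra.coeff_add, Finsupp.add_apply,
    zpow_add₀ (one_sub_ne_zero (sigma_mu_ne_zero hζ c))]

theorem kummerElt_sub (hζ : IsPrimitiveRoot ζ p) (θ θ' : ZG p) :
    kummerElt p ζ (θ - θ') = kummerElt p ζ θ / kummerElt p ζ θ' := by
  rw [eq_div_iff (kummerElt_ne_zero hζ _), ← kummerElt_add hζ, sub_add_cancel]

theorem kummerElt_natCast_mul (θ : ZG p) :
    kummerElt p ζ ((p : ZG p) * θ) = kummerElt p ζ θ ^ p := by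
  rw [kummerElt, kummerElt, ← Finset.prod_pow]
  refine Finset.prod_congr rfl fun c _ => ?_
  rw [← nsmul_eq_mul, MonoidAlgebra.coeff_smul_apply, nsmul_eq_mul,
    mul_comm ((p : ℕ) : ℤ), zpow_mul, zpow_natCast]

/-- The element `(1 - μ T)^θ` is a `p`-th power if and only if `θ` is divisible by `p`. -/
theorem exists_kummerElt_eq_pow_iff (hζ : IsPrimitiveRoot ζ p) (θ : ZG p) :
    (∃ w, kummerElt p ζ θ = w ^ p) ↔ θ ∈ Ideal.span {((p : ℕ) : ZG p)} := by
  constructor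
  · rintro ⟨w, hw⟩
    rw [mem_span_natCast_iff]
    exact dvd_of_prod_eq_pow (sigma_mu_ne_zero hζ) (sigma_mu_injective hζ) _ p w hw
  · intro h
    obtain ⟨y, rfl⟩ := Ideal.mem_span_singleton.1 h
    exact ⟨_, kummerElt_natCast_mul y⟩

variable {L : Type*} [Field L] [Algebra (RatFunc K) L]

theorem radical_ne_zero (hζ : IsPrimitiveRoot ζ p) {x : L} {θ : ZG p}
    (hx : x ^ p = algebraMap (RatFunc K) L (kummerElt p ζ θ)) : x ≠ 0 := by
  rintro rfl
  rw [zero_pow (Fact.out : p.Prime).ne_zero] at hx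
  exact kummerElt_ne_zero hζ θ ((map_eq_zero _).1 hx.symm)

theorem exists_radical_eq_mul (hζ : IsPrimitiveRoot ζ p) {x y : L} {θ θ' : ZG p}
    (hx : x ^ p = algebraMap (RatFunc K) L (kummerElt p ζ θ))
    (hy : y ^ p = algebraMap (RatFunc K) L (kummerElt p ζ θ'))
    (h : θ - θ' ∈ Ideal.span {((p : ℕ) : ZG p)}) :
    ∃ u : RatFunc K, x = algebraMap (RatFunc K) L u * y := by
  obtain ⟨w, hw⟩ := (exists_kummerElt_eq_pow_iff hζ _).2 h
  refine exists_eq_algebraMap_mul (isPrimitiveRoot_ratFunc hζ) (radical_ne_zero hζ hy) (w := w) ?_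
  rw [hx, hy, ← map_pow, ← hw, ← map_mul, ← kummerElt_add hζ, sub_add_cancel]

theorem eq_of_radical_div_mem_range (hζ : IsPrimitiveRoot ζ p) {θ θ' : minusIdeal p} {x y : L}
    (hx : x ^ p = algebraMap (RatFunc K) L (kummerElt p ζ θ))
    (hy : y ^ p = algebraMap (RatFunc K) L (kummerElt p ζ θ'))
    (h : x / y ∈ Set.range (algebraMap (RatFunc K) L)) : cls p θ = cls p θ' := by
  obtain ⟨w, hw⟩ := h
  rw [cls_eq_cls_iff, ← exists_kummerElt_eq_pow_iff hζ]
  refine ⟨w, (algebraMap (RatFunc K) L).injective ?_⟩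
  rw [map_pow, hw, div_pow, hx, hy, kummerElt_sub hζ, map_div₀]

/-- If the automorphisms of `L` over `K(T)` are determined by their values on `p`-th roots of
the `(1 - μ T)^θ`, then there are at most as many as there are classes of `θ`. -/
theorem finite_gal_and_card_le (hp : p ≠ 2) (hζ : IsPrimitiveRoot ζ p)
    {r : THat p → minusIdeal p} (hr : ∀ t, cls p (r t) = t) {x : THat p → L}
    (hx : ∀ t, x t ^ p = algebraMap (RatFunc K) L (kummerElt p ζ (r t)))
    (hext : ∀ σ τ : Gal(L/RatFunc K), (∀ t, σ (x t) = τ (x t)) → σ = τ) :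
    Finite Gal(L/RatFunc K) ∧ Nat.card Gal(L/RatFunc K) ≤ Nat.card (THat p) := by
  have hfin := finite_tHat hp
  have hx0 : ∀ t, x t ≠ 0 := fun t => radical_ne_zero hζ (hx t)
  have hmul : ∀ (σ : Gal(L/RatFunc K)) (s t : THat p),
      σ (x (s + t)) / x (s + t) = σ (x s) / x s * (σ (x t) / x t) := by
    intro σ s t
    have h1 : (x s * x t) ^ p =
        algebraMap (RatFunc K) L (kummerElt p ζ ((r s + r t : minusIdeal p) : ZG p)) := by
      rw [mul_pow, hx, hx, ← map_mul, ← kummerElt_add hζ]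
      rfl
    have h2 : cls p (r (s + t)) = cls p (r s + r t) := by
      have h3 : cls p (r s + r t) = cls p (r s) + cls p (r t) := rfl
      rw [h3, hr, hr, hr]
    obtain ⟨u, hu⟩ := exists_radical_eq_mul hζ (hx (s + t)) h1 ((cls_eq_cls_iff _ _).1 h2)
    have hs := hx0 s
    have ht := hx0 t
    have hu0 : algebraMap (RatFunc K) L u ≠ 0 := by
      intro h
      rw [h, zero_mul] at hu
      exact hx0 _ hu
    rw [hu, map_mul, map_mul, AlgEquiv.commutes]
    field_simp
  let f : Gal(L/RatFunc K) → Multiplicative (THat p) →* L := fun σ =>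
    { toFun := fun t => σ (x t.toAdd) / x t.toAdd
      map_one' := by
        have h1 := hmul σ 0 0
        rw [add_zero] at h1
        exact (mul_eq_left₀ (div_ne_zero ((map_ne_zero σ).2 (hx0 0)) (hx0 0))).1 h1.symm
      map_mul' := fun s t => hmul σ s.toAdd t.toAdd }
  refine finite_and_card_le_of_monoidHom (M := Multiplicative (THat p)) f
    fun σ τ h => hext σ τ fun t => ?_
  have h1 : σ (x t) / x t = τ (x t) / x t := DFunLike.congr_fun h (Multiplicative.ofAdd t)
  exact (div_left_inj' (hx0 t)).1 h1

theorem gal_kummerExt_ext {σ τ : Gal(kummerExt p ζ/RatFunc K)}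
    (h : ∀ x : kummerExt p ζ, (∃ θ ∈ minusIdeal p,
      x ^ p = algebraMap (RatFunc K) (kummerExt p ζ) (kummerElt p ζ θ)) → σ x = τ x) : σ = τ := by
  have h1 : (σ : kummerExt p ζ →ₐ[RatFunc K] kummerExt p ζ) = τ := by
    refine IntermediateField.algHom_ext_of_eq_adjoin (RatFunc K) (rfl : kummerExt p ζ = _) ?_
    rintro x ⟨θ, hθ, hx⟩
    exact h _ ⟨θ, hθ, Subtype.ext hx⟩
  exact AlgEquiv.ext fun x => DFunLike.congr_fun h1 x

theorem isGalois_kummerExt : IsGalois (RatFunc K) (kummerExt p ζ) := by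
  have : Normal (RatFunc K) (kummerExt p ζ) := by
    rw [IntermediateField.normal_iff_forall_map_le']
    intro σ
    rw [kummerExt, IntermediateField.adjoin_map]
    apply IntermediateField.adjoin.mono
    rintro _ ⟨x, ⟨θ, hθ, hx⟩, rfl⟩
    refine ⟨θ, hθ, ?_⟩
    change σ x ^ p = _
    rw [← map_pow, hx, AlgEquiv.commutes]
  exact ⟨⟩

theorem gal_kummerExt_mul_comm (hζ : IsPrimitiveRoot ζ p)
    (σ τ : Gal(kummerExt p ζ/RatFunc K)) : σ * τ = τ * σ := by
  refine gal_kummerExt_ext ?_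
  rintro x ⟨θ, -, hx⟩
  have hx0 := radical_ne_zero hζ hx
  obtain ⟨u, -, hu⟩ := exists_apply_eq_mul (isPrimitiveRoot_ratFunc hζ) hx0 hx σ
  obtain ⟨v, -, hv⟩ := exists_apply_eq_mul (isPrimitiveRoot_ratFunc hζ) hx0 hx τ
  rw [AlgEquiv.mul_apply, AlgEquiv.mul_apply, hu, hv, map_mul, map_mul, AlgEquiv.commutes,
    AlgEquiv.commutes, hu, hv]
  ring

theorem gal_kummerExt_pow_eq_one (hζ : IsPrimitiveRoot ζ p)
    (σ : Gal(kummerExt p ζ/RatFunc K)) : σ ^ p = 1 := by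
  refine gal_kummerExt_ext ?_
  rintro x ⟨θ, -, hx⟩
  have hx0 := radical_ne_zero hζ hx
  obtain ⟨u, hup, hu⟩ := exists_apply_eq_mul (isPrimitiveRoot_ratFunc hζ) hx0 hx σ
  have h1 : ∀ n : ℕ, (σ ^ n) x = algebraMap (RatFunc K) (kummerExt p ζ) u ^ n * x := by
    intro n
    induction n with
    | zero => simp
    | succ n ih =>
      rw [pow_succ, AlgEquiv.mul_apply, hu, map_mul, AlgEquiv.commutes, ih]
      ring
  rw [h1, ← map_pow, hup, map_one, one_mul, AlgEquiv.one_apply]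

theorem isAbelianGalois_kummerExt (hζ : IsPrimitiveRoot ζ p) :
    IsAbelianGalois (RatFunc K) (kummerExt p ζ) :=
  { isGalois_kummerExt with is_comm := ⟨gal_kummerExt_mul_comm hζ⟩ }

theorem exists_radical_kummerExt (ζ : K) {θ : ZG p} (hθ : θ ∈ minusIdeal p) :
    ∃ x : kummerExt p ζ, x ^ p = algebraMap (RatFunc K) (kummerExt p ζ) (kummerElt p ζ θ) := by
  obtain ⟨x, hx⟩ := IsAlgClosed.exists_pow_nat_eq
    (algebraMap (RatFunc K) (AlgebraicClosure (RatFunc K)) (kummerElt p ζ θ))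
    (Fact.out : p.Prime).pos
  exact ⟨⟨x, IntermediateField.subset_adjoin _ _ ⟨θ, hθ, hx⟩⟩, Subtype.ext hx⟩

theorem hasPRank_gal_kummerExt (hp : p ≠ 2) (hζ : IsPrimitiveRoot ζ p) :
    HasPRank p Gal(kummerExt p ζ/RatFunc K) (goodChars p).card := by
  have hfin := finite_tHat hp
  have hgal : IsGalois (RatFunc K) (kummerExt p ζ) := isGalois_kummerExt
  let r : THat p → minusIdeal p := Function.surjInv cls_surjective
  have hr : ∀ t, cls p (r t) = t := Function.surjInv_eq cls_surjective
  choose x hx using fun t => exists_radical_kummerExt ζ (r t).2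
  have hx0 : ∀ t, x t ≠ 0 := fun t => radical_ne_zero hζ (hx t)
  obtain ⟨hfinG, hle⟩ := finite_gal_and_card_le hp hζ hr hx fun σ τ h => by
    refine gal_kummerExt_ext ?_
    rintro y ⟨θ, hθ, hy⟩
    obtain ⟨u, hu⟩ := exists_radical_eq_mul hζ hy (hx (cls p ⟨θ, hθ⟩))
      ((cls_eq_cls_iff ⟨θ, hθ⟩ _).1 (hr _).symm)
    rw [hu, map_mul, map_mul, AlgEquiv.commutes, AlgEquiv.commutes, h]
  have hge : Nat.card (THat p) ≤ Nat.card Gal(kummerExt p ζ/RatFunc K) :=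
    card_le_card_gal (isPrimitiveRoot_ratFunc hζ) hx0 (fun t => ⟨_, (hx t).symm⟩) fun s t h => by
      rw [← hr s, ← hr t]
      exact eq_of_radical_div_mem_range hζ (hx s) (hx t) h
  let _ : CommGroup Gal(kummerExt p ζ/RatFunc K) :=
    { (inferInstance : Group Gal(kummerExt p ζ/RatFunc K)) with
      mul_comm := gal_kummerExt_mul_comm hζ }
  refine hasPRank_of_card ?_ (gal_kummerExt_pow_eq_one hζ)
  rw [← nat_card_tHat hp]
  exact le_antisymm hle hge

end Kummer

section Series

open scoped RatFunc

variable {K : Type*} [Field K]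

theorem ofPowerSeries_coe (P : Polynomial K) :
    HahnSeries.ofPowerSeries ℤ K (P : PowerSeries K) =
      algebraMap (RatFunc K) (LaurentSeries K) (algebraMap (Polynomial K) (RatFunc K) P) :=
  RatFunc.coe_coe P

theorem linearIndependent_coeff {ι : Type*} {f : ι → PowerSeries K}
    (hf : LinearIndependent (RatFunc K) fun i => HahnSeries.ofPowerSeries ℤ K (f i))
    (d : ℕ → K) (hd : ∀ n, d n ≠ 0) :
    LinearIndependent K fun i n => PowerSeries.coeff n (f i) / d n := by
  rw [linearIndependent_iff'] at hf ⊢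
  intro s g hg i hi
  have h1 : ∑ i ∈ s, PowerSeries.C (g i) * f i = 0 := by
    ext n
    have h2 := congrFun hg n
    simp only [Finset.sum_apply, Pi.smul_apply, smul_eq_mul, Pi.zero_apply, ← mul_div_assoc] at h2
    rw [← Finset.sum_div, div_eq_zero_iff, or_iff_left (hd n)] at h2
    simpa [map_sum, PowerSeries.coeff_C_mul] using h2
  have h3 := hf s (fun i => RatFunc.C (g i)) (by
    rw [← map_zero (HahnSeries.ofPowerSeries ℤ K), ← h1, map_sum]
    refine Finset.sum_congr rfl fun j _ => ?_
    rw [Algebra.smul_def, map_mul, ← RatFunc.algebraMap_C, ← ofPowerSeries_coe,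
      Polynomial.coe_C]) i hi
  exact (map_eq_zero RatFunc.C).1 h3

variable {p : ℕ} [Fact p.Prime] [NumberField K] [IsCyclotomicExtension {p} ℚ K] {ζ : K}

/-- The binomial series `(1 - a T)^x` with rational exponent, as a Laurent series. -/
def binomLaurent (a : K) (x : ℚ) : LaurentSeries K :=
  HahnSeries.ofPowerSeries ℤ K (PowerSeries.rescale (-a) (PowerSeries.binomialSeries K x))

theorem binomLaurent_add (a : K) (x y : ℚ) :
    binomLaurent a (x + y) = binomLaurent a x * binomLaurent a y := by
  simp [binomLaurent]

theorem binomLaurent_natCast_mul (a : K) (n : ℕ) (x : ℚ) :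
    binomLaurent a (n * x) = binomLaurent a x ^ n := by
  induction n with
  | zero => simp [binomLaurent]
  | succ n ih => rw [Nat.cast_succ, add_mul, one_mul, binomLaurent_add, ih, pow_succ]

theorem binomLaurent_one (a : K) : binomLaurent a 1 =
    algebraMap (RatFunc K) (LaurentSeries K) (1 - RatFunc.C a * RatFunc.X) := by
  have h := PowerSeries.binomialSeries_nat (R := ℚ) (A := K) 1
  rw [Nat.cast_one, pow_one] at h
  rw [binomLaurent, h, ← algebraMap_one_sub, ← ofPowerSeries_coe]
  congr 1
  simp only [map_add, map_one, PowerSeries.rescale_X, map_neg, Polynomial.coe_sub,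
    Polynomial.coe_one, Polynomial.coe_mul, Polynomial.coe_C, Polynomial.coe_X]
  ring

theorem binomLaurent_intCast (a : K) (k : ℤ) : binomLaurent a k =
    algebraMap (RatFunc K) (LaurentSeries K) (1 - RatFunc.C a * RatFunc.X) ^ k := by
  have hn : ∀ n : ℕ, binomLaurent a n =
      algebraMap (RatFunc K) (LaurentSeries K) (1 - RatFunc.C a * RatFunc.X) ^ n := by
    intro n
    rw [← binomLaurent_one, ← binomLaurent_natCast_mul, mul_one]
  obtain ⟨n, rfl | rfl⟩ := k.eq_nat_or_neg
  · rw [Int.cast_natCast, hn, zpow_natCast]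
  · rw [zpow_neg, zpow_natCast, ← hn, Int.cast_neg, Int.cast_natCast]
    refine eq_inv_of_mul_eq_one_left ?_
    rw [← binomLaurent_add, neg_add_cancel]
    simp [binomLaurent]

theorem ofPowerSeries_binomFactor (k : ℤ) (c : G p) :
    HahnSeries.ofPowerSeries ℤ K (binomFactor p ζ k c) =
      binomLaurent (sigma p K c (mu p ζ)) ((k : ℚ) / p) := by
  rw [binomLaurent]
  congr 1
  ext n
  rw [binomFactor, PowerSeries.coeff_mk, PowerSeries.coeff_rescale,
    PowerSeries.binomialSeries_coeff, Algebra.smul_def, mul_one]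

/-- The binomial series `f[θ]` is a `p`-th root of `(1 - μ T)^θ`. -/
theorem ofPowerSeries_binomSeries_pow (θ : ZG p) :
    HahnSeries.ofPowerSeries ℤ K (binomSeries p ζ θ) ^ p =
      algebraMap (RatFunc K) (LaurentSeries K) (kummerElt p ζ θ) := by
  have hp0 : (p : ℚ) ≠ 0 := Nat.cast_ne_zero.2 (Fact.out : p.Prime).ne_zero
  rw [binomSeries, kummerElt, map_prod, map_prod, ← Finset.prod_pow]
  refine Finset.prod_congr rfl fun c _ => ?_
  rw [ofPowerSeries_binomFactor, ← binomLaurent_natCast_mul, mul_div_cancel₀ _ hp0,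
    binomLaurent_intCast, map_zpow₀]

theorem linearIndependent_coeffA (hζ : IsPrimitiveRoot ζ p) {r : THat p → minusIdeal p}
    (hr : ∀ t, cls p (r t) = t) (d : ℕ → K) (hd : ∀ n, d n ≠ 0) :
    LinearIndependent K fun t n => coeffA p ζ (r t : ZG p) n / d n := by
  refine linearIndependent_coeff (f := fun t => binomSeries p ζ (r t : ZG p)) ?_ d hd
  have hx : ∀ t, HahnSeries.ofPowerSeries ℤ K (binomSeries p ζ (r t : ZG p)) ^ p =
      algebraMap (RatFunc K) (LaurentSeries K) (kummerElt p ζ (r t : ZG p)) := fun t =>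
    ofPowerSeries_binomSeries_pow _
  refine linearIndependent_radicals (isPrimitiveRoot_ratFunc hζ)
    (fun t => radical_ne_zero hζ (hx t)) (fun t => ⟨_, (hx t).symm⟩) fun s t h => ?_
  rw [← hr s, ← hr t]
  exact eq_of_radical_div_mem_range hζ (hx s) (hx t) h

theorem linearIndependent_vecA (hζ : IsPrimitiveRoot ζ p) {r : THat p → minusIdeal p}
    (hr : ∀ t, cls p (r t) = t) : LinearIndependent K fun t => vecA p ζ (r t : ZG p) :=
  linearIndependent_coeffA hζ hr _ fun _ =>
    zpow_ne_zero _ (Nat.cast_ne_zero.2 (Fact.out : p.Prime).ne_zero)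

end Series

section Equivariance

variable {p : ℕ}

theorem exists_equivariant_section {Γ X Y : Type*} [Group Γ] [MulAction Γ X] [MulAction Γ Y]
    {f : Y → X} (hf : ∀ (g : Γ) y, f (g • y) = g • f y)
    (hlift : ∀ x, ∃ y, f y = x ∧ ∀ g : Γ, g • x = x → g • y = y) :
    ∃ r : X → Y, (∀ x, f (r x) = x) ∧ ∀ (g : Γ) x, r (g • x) = g • r x := by
  choose y hy hstab using hlift
  let o : X → X := fun x => (Quotient.out (Quotient.mk (MulAction.orbitRel Γ X) x))
  have ho : ∀ x, ∃ g : Γ, g • o x = x := fun x =>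
    MulAction.orbitRel_apply.1 ((MulAction.orbitRel Γ X).iseqv.symm
      (Quotient.mk_out (s := MulAction.orbitRel Γ X) x))
  have ho_smul : ∀ (g : Γ) x, o (g • x) = o x := fun g x =>
    congrArg Quotient.out (Quotient.sound (s := MulAction.orbitRel Γ X) ⟨g, rfl⟩)
  choose a ha using ho
  refine ⟨fun x => a x • y (o x), fun x => by rw [hf, hy, ha], fun g x => ?_⟩
  change a (g • x) • y (o (g • x)) = g • a x • y (o x)
  have h1 : ((g * a x)⁻¹ * a (g • x)) • o x = o x := by
    have h2 := ha (g • x)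
    rw [ho_smul] at h2
    rw [mul_smul, h2, inv_smul_eq_iff, mul_smul, ha]
  have h3 := hstab _ _ h1
  rw [mul_smul, inv_smul_eq_iff, mul_smul] at h3
  rw [ho_smul, h3]

theorem sig_mul (a b : G p) : sig p (a * b) = sig p a * sig p b := by
  simp [sig, MonoidAlgebra.single_mul_single]

theorem sig_one : sig p 1 = 1 := rfl

variable (p) in
/-- The homomorphism `c ↦ σ_c` from `G` to `ℤ[G]`. -/
def sigHom : G p →* ZG p where
  toFun := sig p
  map_one' := sig_one
  map_mul' := sig_mul

theorem exists_equivariant_representatives [Fact p.Prime] :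
    ∃ r : THat p → minusIdeal p, (∀ t, cls p (r t) = t) ∧
      ∀ (b : G p) (t : THat p), r (sig p b • t) = sig p b • r t := by
  let _ : MulAction (G p) (THat p) := MulAction.compHom _ (sigHom p)
  let _ : MulAction (G p) (minusIdeal p) := MulAction.compHom _ (sigHom p)
  have hcls : ∀ (b : G p) (θ : minusIdeal p), cls p (b • θ) = b • cls p θ := fun _ _ => rfl
  refine exists_equivariant_section (Γ := G p) (f := cls p) hcls fun t => ?_
  classical
  obtain ⟨θ, rfl⟩ := cls_surjective t
  let H := MulAction.stabilizer (G p) (cls p θ)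
  have hadd : ∀ (b : G p) (s : Finset H) (f : H → minusIdeal p),
      b • ∑ h ∈ s, f h = ∑ h ∈ s, b • f h := fun b s f => Finset.smul_sum (r := sig p b)
  have hsmul : ∀ (b : G p) (n : ℕ) (x : minusIdeal p), b • n • x = n • b • x := fun b n x =>
    smul_comm (sig p b) n x
  have hcoprime : ((Fintype.card H : ℕ) : ZMod p) ≠ 0 := by
    rw [Ne, ZMod.natCast_eq_zero_iff]
    intro hdvd
    have h1 := hdvd.trans (Subgroup.card_subgroup_dvd_card H |>.trans (by
      rw [Nat.card_eq_fintype_card, ZMod.card_units_eq_totient, Nat.totient_prime Fact.out]) |>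
        (Nat.card_eq_fintype_card (α := H) ▸ ·))
    have hp := (Fact.out : p.Prime).one_lt
    have := Nat.le_of_dvd (by omega) h1
    omega
  let m : ℕ := ((Fintype.card H : ZMod p)⁻¹).val
  refine ⟨m • ∑ h : H, (h : G p) • θ, ?_, fun g hg => ?_⟩
  · have h1 : cls p (m • ∑ h : H, (h : G p) • θ) = m • ∑ h : H, (h : G p) • cls p θ := by
      change Submodule.mkQ _ _ = _
      rw [map_nsmul, map_sum]
      rfl
    have h2 : ∀ h : H, (h : G p) • cls p θ = cls p θ := fun h => h.2
    rw [h1, Finset.sum_congr rfl fun h _ => h2 h, Finset.sum_const, Finset.card_univ, smul_smul]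
    conv_rhs => rw [← one_nsmul (cls p θ)]
    rw [nsmul_eq_nsmul_iff_modEq]
    refine Nat.ModEq.of_dvd (addOrderOf_dvd_of_nsmul_eq_zero (nsmul_tHat_eq_zero _)) ?_
    rw [← ZMod.natCast_eq_natCast_iff, Nat.cast_mul, ZMod.natCast_zmod_val, Nat.cast_one,
      inv_mul_cancel₀ hcoprime]
  · rw [hsmul, hadd]
    congr 1
    simp_rw [smul_smul]
    exact Equiv.sum_comp (Equiv.mulLeft (⟨g, hg⟩ : H)) fun h : H => (h : G p) • θ

variable [Fact p.Prime] {K : Type*} [Field K] [NumberField K]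
  [IsCyclotomicExtension {p} ℚ K] {ζ : K}

theorem sigma_mul_apply (b c : G p) (x : K) :
    sigma p K (b * c) x = sigma p K b (sigma p K c x) := by
  rw [sigma, map_mul]
  rfl

theorem map_binomFactor (k : ℤ) (b c : G p) :
    PowerSeries.map (sigma p K b : K →+* K) (binomFactor p ζ k c) = binomFactor p ζ k (b * c) := by
  ext n
  simp [binomFactor, sigma_mul_apply]

theorem binomSeries_sig_mul (b : G p) (θ : ZG p) : binomSeries p ζ (sig p b * θ) =
    PowerSeries.map (sigma p K b : K →+* K) (binomSeries p ζ θ) := by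
  rw [binomSeries, binomSeries, map_prod, ← Equiv.prod_comp (Equiv.mulLeft b)]
  refine Finset.prod_congr rfl fun c _ => ?_
  rw [map_binomFactor, Equiv.coe_mulLeft, sig, MonoidAlgebra.coeff_single_mul_apply, one_mul,
    inv_mul_cancel_left]

theorem coeffA_sig_mul (b : G p) (θ : ZG p) (n : ℕ) :
    coeffA p ζ (sig p b * θ) n = sigma p K b (coeffA p ζ θ n) := by
  rw [coeffA, binomSeries_sig_mul, PowerSeries.coeff_map]
  rfl

theorem coord_mul_sigma (hζ : IsPrimitiveRoot ζ p) (b c : G p) (x : K) :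
    coord p ζ (b * c) (sigma p K b x) = coord p ζ c x := by
  rw [coord, coord, ← sigma_zeta p hζ, ← sigma_zeta p hζ, sigma_mul_apply, ← map_inv₀, ← map_mul,
    Algebra.trace_eq_of_algEquiv, Algebra.trace_eq_of_algEquiv]

theorem vecU_mul_sig_mul (hζ : IsPrimitiveRoot ζ p) (b c : G p) (θ : ZG p) :
    vecU p ζ (b * c) (sig p b * θ) = vecU p ζ c θ := by
  funext n
  rw [vecU, vecU, coeffA_sig_mul, coord_mul_sigma hζ]

theorem vecU_eq_vecU_one (hζ : IsPrimitiveRoot ζ p) {r : THat p → minusIdeal p}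
    (hr : ∀ (b : G p) (t : THat p), r (sig p b • t) = sig p b • r t) (c : G p) (t : THat p) :
    vecU p ζ c (r t : ZG p) = vecU p ζ 1 (r (sig p c⁻¹ • t) : ZG p) := by
  rw [hr, ← vecU_mul_sig_mul hζ c⁻¹ c (r t : ZG p), inv_mul_cancel]
  rfl

/-- For a `G`-equivariant choice of representatives the vectors `u^{(1)}` of the classes are
linearly independent over `ℚ`. -/
theorem linearIndependent_vecU_one (hp : p ≠ 2) (hζ : IsPrimitiveRoot ζ p)
    {r : THat p → minusIdeal p} (hr : ∀ t, cls p (r t) = t)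
    (hrG : ∀ (b : G p) (t : THat p), r (sig p b • t) = sig p b • r t) :
    LinearIndependent ℚ fun t => vecU p ζ 1 (r t : ZG p) := by
  have := finite_tHat hp
  have := Fintype.ofFinite (THat p)
  let W : THat p → ℕ → K := fun t n => algebraMap ℚ K (vecU p ζ 1 (r t : ZG p) n)
  have hA : LinearIndependent K fun t n => coeffA p ζ (r t : ZG p) n := by
    have h := linearIndependent_coeffA hζ hr (fun _ => 1) fun _ => one_ne_zero
    simpa only [div_one] using h
  have hspan : Submodule.span K (Set.range fun t n => coeffA p ζ (r t : ZG p) n) ≤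
      Submodule.span K (Set.range W) := by
    rw [Submodule.span_le]
    rintro _ ⟨t, rfl⟩
    have h1 : (fun n => coeffA p ζ (r t : ZG p) n) =
        ∑ c : G p, ζ ^ (c : ZMod p).val • W (sig p c⁻¹ • t) := by
      funext n
      rw [sum_coord hζ (coeffA p ζ (r t : ZG p) n), Finset.sum_apply]
      refine Finset.sum_congr rfl fun c _ => ?_
      have h2 := congrFun (vecU_eq_vecU_one hζ hrG c t) n
      rw [Pi.smul_apply, smul_eq_mul, mul_comm]
      congr 2
    change (fun n => coeffA p ζ (r t : ZG p) n) ∈ _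
    rw [h1]
    exact Submodule.sum_mem _ fun c _ =>
      Submodule.smul_mem _ _ (Submodule.subset_span ⟨_, rfl⟩)
  have hW : LinearIndependent K W := by
    rw [linearIndependent_iff_card_le_finrank_span, ← finrank_span_eq_card hA]
    have : Module.Finite K (Submodule.span K (Set.range W)) :=
      Module.Finite.span_of_finite K (Set.finite_range W)
    exact Submodule.finrank_mono hspan
  exact LinearIndependent.of_comp
    ((Algebra.linearMap ℚ K).compLeft ℕ) (hW.restrict_scalars' ℚ)

theorem vecU_eq_vecU_iff (hp : p ≠ 2) (hζ : IsPrimitiveRoot ζ p)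
    {r : THat p → minusIdeal p} (hr : ∀ t, cls p (r t) = t)
    (hrG : ∀ (b : G p) (t : THat p), r (sig p b • t) = sig p b • r t)
    (t t' : THat p) (c c' : G p) :
    vecU p ζ c (r t : ZG p) = vecU p ζ c' (r t' : ZG p) ↔
      ∃ b : G p, t' = sig p b • t ∧ c' = b * c := by
  constructor
  · intro h
    rw [vecU_eq_vecU_one hζ hrG, vecU_eq_vecU_one hζ hrG c'] at h
    have h1 := (linearIndependent_vecU_one hp hζ hr hrG).injective h
    refine ⟨c' * c⁻¹, ?_, by rw [inv_mul_cancel_right]⟩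
    rw [sig_mul, mul_smul, h1, smul_smul, ← sig_mul, mul_inv_cancel, sig_one, one_smul]
  · rintro ⟨b, rfl, rfl⟩
    rw [hrG]
    exact (vecU_mul_sig_mul hζ b c _).symm

end Equivariance

end BinomialStickelberger

end

open BinomialStickelberger in
theorem proposition2 (p : ℕ) [Fact p.Prime] (hp : p ≠ 2)
    (K : Type*) [Field K] [NumberField K] [IsCyclotomicExtension {p} ℚ K]
    (ζ : K) (hζ : IsPrimitiveRoot ζ p) :
    -- the equality of `p`-ranks
    (∃ D : ℕ, D + irregularityIndex p = (p - 1) / 2 ∧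
      HasPRank p (Multiplicative (THat p)) D ∧
      IsAbelianGalois (RatFunc K) (kummerExt p ζ) ∧
      HasPRank p Gal(kummerExt p ζ/RatFunc K) D) ∧
    -- linear independence over `K`, for every choice `r` of representatives
    (∀ r : THat p → minusIdeal p, (∀ t, cls p (r t) = t) →
      ∀ F : Set (THat p), LinearIndependent K (fun t : F => vecA p ζ (r t : ZG p))) ∧
    -- choices of representatives compatible with the action of the Galois group exist
    (∃ r : THat p → minusIdeal p, (∀ t, cls p (r t) = t) ∧
      ∀ (b : G p) (t : THat p), r (sig p b • t) = sig p b • r t) ∧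
    -- linear independence over `ℚ`, for every such choice
    (∀ r : THat p → minusIdeal p, (∀ t, cls p (r t) = t) →
      (∀ (b : G p) (t : THat p), r (sig p b • t) = sig p b • r t) →
      (∀ F : Set (THat p),
        LinearIndepOn ℚ id
          {v : ℕ → ℚ | ∃ (t : THat p) (c : G p),
            (∀ b : G p, sig p b • t ∈ F) ∧ v = vecU p ζ c (r t : ZG p)}) ∧
      ∀ (t t' : THat p) (c c' : G p),
        vecU p ζ c (r t : ZG p) = vecU p ζ c' (r t' : ZG p) ↔
          ∃ b : G p, t' = sig p b • t ∧ c' = b * c) := by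
  refine ⟨⟨(goodChars p).card, card_goodChars_add_irregularityIndex hp, hasPRank_tHat hp,
    isAbelianGalois_kummerExt hζ, hasPRank_gal_kummerExt hp hζ⟩, fun r hr F => ?_,
    exists_equivariant_representatives, fun r hr hrG => ⟨fun F => ?_, fun t t' c c' =>
      vecU_eq_vecU_iff hp hζ hr hrG t t' c c'⟩⟩
  · exact (linearIndependent_vecA hζ hr).comp _ Subtype.val_injective
  · refine (linearIndependent_vecU_one hp hζ hr hrG).linearIndepOn_id.mono ?_
    rintro _ ⟨t, c, -, rfl⟩
    exact ⟨_, (vecU_eq_vecU_one hζ hrG c t).symm⟩
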